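/- **Setting.** A *Gaussian map* $\mathbb R^m\to\mathbb R^n$ is a triple $(A,b,\Sigma)$ with $A\in\mathbb R^{n\times m}$, $b\in\mathbb R^n$ and $\Sigma\in\mathbb R^{n\times n}$ positive semidefinite, written $x\mapsto Ax+b+\mathcal N(\Sigma)$. With $(A,b,\Sigma)\circ(C,d,\Xi)=(AC,Ad+b,A\Xi A^T+\Sigma)$ and block-diagonal tensor products, these form a symmetric monoidal category $\mathrm{Gauss}$ with unit $I=\mathbb R^0$, copying maps $x\mapsto(x,x)$ and deleting maps. A map is *deterministic* if it commutes with copying. For distributions (states) $\mu,\nu:I\to X$ and $f,g:X\to Y$ write $f=_\mu g$ if $\langle \mathrm{id},f\rangle\mu=\langle \mathrm{id},g\rangle\mu$, and $\mu\ll\nu$ if $f=_\nu g$ implies $f=_\mu g$ for all $Y$ and all $f,g:X\to Y$. A *conditional* of $\psi:I\to Y\otimes K$ is a map $\psi|_K:K\to Y$ with $\psi=\langle\psi|_K,\mathrm{id}_K\rangle\psi_K$, where $\psi_K$ is the marginal. A morphism $X\rightsquigarrow Y$ of $\mathrm{Obs}(\mathrm{Gauss})$ is a triple $(K,f,o)$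 with $f:X\to Y\otimes K$ in $\mathrm{Gauss}$ and $o:I\to K$ deterministic. Composition is $(K',f',o')\bullet(K,f,o)=(K'\otimes K,(f'\otimes \mathrm{id}_K)f,o'\otimes o)$, further $\mathrm{id}_A\otimes(K,f,o)=(K,\mathrm{id}_A\otimes f,o)$, and $J(f)=(I,f,\mathrm{id}_I)$. States satisfy $(K,\psi,o)\sim(K',\psi',o')$ if either $o\ll\psi_K$, $o'\ll\psi'_{K'}$ and $\psi|_K\circ o=\psi'|_{K'}\circ o'$, or $o\not\ll\psi_K$ and $o'\not\ll\psi'_{K'}$. For $F,G:X\rightsquigarrow Y$ put $F\approx G$ if $(\mathrm{id}_A\otimes F)\bullet\Psi\sim(\mathrm{id}_A\otimes G)\bullet\Psi$ for all $A$ and all states $\Psi:I\rightsquigarrow A\otimes X$. Finally $\mathrm{Cond}(\mathrm{Gauss})=\mathrm{Obs}(\mathrm{Gauss})/{\approx}$. **Language.** *Expressions* over a context $\Gamma$ of real variables are $s::=x\mid s+s\mid\alpha\cdot s\mid\underline\beta$ ($\alpha,\beta\in\mathbb R$). *Programs* $\Gamma\vdash t:\mathbb R^k$ are $$t::=\nu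 x.t\;\mid\;(s=:=s')\,t\;\mid\;\mathrm r[s_1,\dots,s_k]\;\mid\;\bot ,$$ where $\nu x.t$ samples $x$ from $\mathcal N(0,1)$, $(s=:=s')\,t$ conditions on $s=s'$ and continues as $t$, $\mathrm r$ returns a tuple, and $\bot$ is failure. A program with $n$ variables in context and result type $\mathbb R^k$ denotes a morphism $[\![t]\!]:n\rightsquigarrow k$ of $\mathrm{Cond}(\mathrm{Gauss})$: $\mathrm r[\vec s]$ denotes $J$ of the affine map $\vec s$; $\nu x.t$ denotes $[\![t]\!]\bullet J(\mathrm{id}_\Gamma\otimes\mathcal N(0,1))$; $(s=:=s')\,t$ denotes $[\![t]\!]\bullet(\mathbb R,\langle\mathrm{id}_\Gamma,s-s'\rangle,0)$; and $\bot$ denotes the morphism that always fails (its extra output is constantly $0$ and is observed to be $1$). **Axioms.** The theory of pointed vector spaces is that of real vector spaces with constants $\underline\beta$ (zero vector $\underline0$) subject to $\alpha\cdot\underline\beta=\underline{\alpha\beta}$ and $\underline\alpha+\underline\beta=\underline{\alpha+\beta}$. The axioms are - (DISC) $\nu x.\mathrm r[]\equiv\mathrm r[]$; - (ORTH) $\nu\vec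 x.\mathrm r[U\vec x]\equiv\nu\vec x.\mathrm r[\vec x]$ for every $n$ and every orthogonal $n\times n$ matrix $U$; - (C1) $(a=:=b)(c=:=d)\mathrm r[]\equiv(c=:=d)(a=:=b)\mathrm r[]$; - (C2) $(a=:=b)\,\nu x.\mathrm r[x]\equiv\nu x.(a=:=b)\mathrm r[x]$; - (C3) $(a=:=b)\bot\equiv\bot$ (for every result type); - (TAUT) $(a=:=a)\mathrm r[]\equiv\mathrm r[]$; - (FAIL) $(\underline0=:=\underline1)\mathrm r[]\equiv\bot$; - (SUBS) $(a=:=b)\mathrm r[a]\equiv(a=:=b)\mathrm r[b]$; - (INIT) $\nu x.(x=:=\underline c)\mathrm r[x]\equiv\mathrm r[\underline c]$ for every $c\in\mathbb R$; - (CONG) $(s=:=t)\mathrm r[]\equiv(s'=:=t')\mathrm r[]$ whenever the equations $s=t$ and $s'=t'$ over $\Gamma$ are derivable from each other in the theory of pointed vector spaces (with the variables of $\Gamma$ held fixed). *Derivable* equality is the least congruence on programs that contains the axioms, contains equality of expressions in the theory of pointed vector spaces, and is closed under substituting expressions for variables and under the substitution $t[\vec x.u/\mathrm{return}]$, which replaces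 each $\mathrm r[\vec s]$ in $t$ by $u[\vec s/\vec x]$. **Proposition.** All axioms (DISC)–(CONG) are valid in $\mathrm{Cond}(\mathrm{Gauss})$: for each instance $t\equiv u$ we have $[\![t]\!]=[\![u]\!]$. Moreover the equational theory is sound, i.e. $[\![t]\!]=[\![u]\!]$ whenever $t\equiv u$ is derivable, and hence consistent: $\mathrm r[]\equiv\bot$ (closed programs of type $\mathbb R^0$) is not derivable. -/

import Mathlib

set_option linter.unusedSectionVars false

namespace CondGauss

open scoped Matrix

/-! ## The Markov category of Gaussian maps -/

/-- A Gaussian map `ℝ^X → ℝ^Y`, written informally `x ↦ A x + b + 𝒩(Σ)`: a matrix `A = lin`, a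
vector `b = shift` and a positive semidefinite covariance matrix `Σ = cov`.  Objects are finite
index sets; the object `n` is `Fin n`, the tensor product of objects is the disjoint union `⊕`,
and the unit object is `Fin 0`. -/
@[ext]
structure Hom (X Y : Type) : Type where
  lin : Matrix Y X ℝ
  shift : Y → ℝ
  cov : Matrix Y Y ℝ
  psd : cov.PosSemidef

namespace Hom

variable {X Y Z W : Type} [Fintype X] [Fintype Y] [Fintype Z] [Fintype W]

/-- The deterministic affine map `x ↦ A x + b`. -/
def affine (A : Matrix Y X ℝ) (b : Y → ℝ) : Hom X Y := ⟨A, b, 0, Matrix.PosSemidef.zero⟩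

open Classical in
/-- The coordinate map `(x_i)_{i ∈ X} ↦ (x_{w j})_{j ∈ Y}` of a function `w : Y → X`.  All
structural maps (identities, associators, unitors, symmetries, copying, deleting and
projections) are of this form. -/
noncomputable def wire (w : Y → X) : Hom X Y :=
  affine (Matrix.of fun j i => if w j = i then 1 else 0) 0

/-- The identity map. -/
noncomputable def id (X : Type) [Fintype X] : Hom X X := wire _root_.id

/-- Composition `g ∘ f`; the noise accumulates independently. -/
def comp (g : Hom Y Z) (f : Hom X Y) : Hom X Z where
  lin := g.lin * f.lin
  shift := g.lin *ᵥ f.shift + g.shift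
  cov := g.lin * f.cov * g.linᵀ + g.cov
  psd := by
    have h := f.psd.mul_mul_conjTranspose_same g.lin
    rw [Matrix.conjTranspose_eq_transpose_of_trivial] at h
    exact h.add g.psd

theorem psd_fromBlocks {P : Matrix X X ℝ} {Q : Matrix Y Y ℝ} (hP : P.PosSemidef)
    (hQ : Q.PosSemidef) : (Matrix.fromBlocks P 0 0 Q).PosSemidef := by
  classical
  have h1 := hP.mul_mul_conjTranspose_same
    (Matrix.fromRows (1 : Matrix X X ℝ) (0 : Matrix Y X ℝ))
  have h2 := hQ.mul_mul_conjTranspose_same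
    (Matrix.fromRows (0 : Matrix X Y ℝ) (1 : Matrix Y Y ℝ))
  have h := h1.add h2
  convert h using 1
  ext (i | i) (j | j) <;>
    simp [Matrix.conjTranspose_eq_transpose_of_trivial, Matrix.transpose_fromRows,
      Matrix.fromRows_mul, Matrix.mul_fromCols, Matrix.fromRows_apply_inl]

/-- Parallel composition `f ⊗ g`. -/
def tensor (f : Hom X Y) (g : Hom Z W) : Hom (X ⊕ Z) (Y ⊕ W) where
  lin := Matrix.fromBlocks f.lin 0 0 g.lin
  shift := Sum.elim f.shift g.shift
  cov := Matrix.fromBlocks f.cov 0 0 g.cov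
  psd := psd_fromBlocks f.psd g.psd

/-- Copying `x ↦ (x, x)`. -/
noncomputable def copy (X : Type) [Fintype X] : Hom X (X ⊕ X) :=
  wire (Sum.elim _root_.id _root_.id)

/-- Deleting `x ↦ ()`. -/
noncomputable def del (X : Type) [Fintype X] : Hom X (Fin 0) := wire Fin.elim0

/-- Tupling `⟨f, g⟩`. -/
noncomputable def pair (f : Hom X Y) (g : Hom X Z) : Hom X (Y ⊕ Z) := (f.tensor g).comp (copy X)

/-- The first marginal. -/
noncomputable def margL (f : Hom X (Y ⊕ Z)) : Hom X Y := (wire Sum.inl).comp f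

/-- The second marginal. -/
noncomputable def margR (f : Hom X (Y ⊕ Z)) : Hom X Z := (wire Sum.inr).comp f

/-- A map is deterministic if it commutes with copying. -/
def IsDeterministic (f : Hom X Y) : Prop :=
  (copy Y).comp f = (f.tensor f).comp (copy X)

/-- Almost sure equality of `f` and `g` with respect to a distribution `μ`. -/
def AsEq (μ : Hom (Fin 0) X) (f g : Hom X Y) : Prop :=
  (pair (id X) f).comp μ = (pair (id X) g).comp μ

/-- Absolute continuity `μ ≪ ν` of distributions. -/
def AbsCont (μ ν : Hom (Fin 0) X) : Prop :=
  ∀ (Y : Type) [Fintype Y] (f g : Hom X Y), AsEq ν f g → AsEq μ f g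

/-- `κ : K → Y` is a conditional distribution, given the `K`-component, of the joint distribution
`ψ` on `Y ⊗ K`. -/
def IsConditional (ψ : Hom (Fin 0) (X ⊕ Y)) (κ : Hom Y X) : Prop :=
  ψ = (pair κ (id Y)).comp ψ.margR

/-- The standard normal distribution on `ℝ`. -/
def stdNormal : Hom (Fin 0) (Fin 1) := ⟨0, 0, 1, Matrix.PosSemidef.one⟩

/-! Facts needed to see that the definitions below are well formed. -/

theorem wire_lin_mul (w : Y → X) (M : Matrix X Z ℝ) :
    (wire w).lin * M = M.submatrix w _root_.id := by
  classical
  ext i j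
  simp [wire, affine, Matrix.mul_apply]

theorem mul_wire_lin_transpose (w : Y → X) (M : Matrix Z X ℝ) :
    M * (wire w).linᵀ = M.submatrix _root_.id w := by
  classical
  ext i j
  simp [wire, affine, Matrix.mul_apply]

theorem wire_lin_mulVec (w : Y → X) (v : X → ℝ) : (wire w).lin *ᵥ v = v ∘ w := by
  classical
  ext i
  simp [wire, affine, Matrix.mulVec, dotProduct]

theorem wire_comp_lin (w : Z → Y) (f : Hom X Y) :
    ((wire w).comp f).lin = f.lin.submatrix w _root_.id := wire_lin_mul w f.lin

theorem wire_comp_shift (w : Z → Y) (f : Hom X Y) : ((wire w).comp f).shift = f.shift ∘ w := by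
  have : (wire w).shift = 0 := rfl
  simp [comp, wire_lin_mulVec, this]

theorem wire_comp_cov (w : Z → Y) (f : Hom X Y) :
    ((wire w).comp f).cov = f.cov.submatrix w w := by
  have : (wire w).cov = 0 := rfl
  simp [comp, wire_lin_mul, mul_wire_lin_transpose, this]

theorem mul_copy_lin (A : Matrix Y X ℝ) (B : Matrix Z X ℝ) :
    Matrix.fromBlocks A 0 0 B * (copy X).lin = Matrix.fromRows A B := by
  classical
  ext (i | i) j
  · simp only [copy, wire, affine, Matrix.mul_apply, Fintype.sum_sum_type]
    simp only [Matrix.of_apply, Matrix.fromBlocks_apply₁₁, Matrix.fromBlocks_apply₁₂,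
      Matrix.zero_apply, zero_mul, Finset.sum_const_zero, add_zero, Matrix.fromRows_apply_inl]
    rw [Finset.sum_eq_single j] <;> simp +contextual
  · simp only [copy, wire, affine, Matrix.mul_apply, Fintype.sum_sum_type]
    simp only [Matrix.of_apply, Matrix.fromBlocks_apply₂₁, Matrix.fromBlocks_apply₂₂,
      Matrix.zero_apply, zero_mul, Finset.sum_const_zero, zero_add, Matrix.fromRows_apply_inr]
    rw [Finset.sum_eq_single j] <;> simp +contextual

theorem pair_lin (f : Hom X Y) (g : Hom X Z) : (pair f g).lin = Matrix.fromRows f.lin g.lin :=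
  mul_copy_lin f.lin g.lin

theorem pair_shift (f : Hom X Y) (g : Hom X Z) : (pair f g).shift = Sum.elim f.shift g.shift := by
  have : (copy X).shift = 0 := rfl
  simp [pair, comp, tensor, this]

theorem pair_cov (f : Hom X Y) (g : Hom X Z) :
    (pair f g).cov = Matrix.fromBlocks f.cov 0 0 g.cov := by
  have : (copy X).cov = 0 := rfl
  simp [pair, comp, tensor, this]

theorem isDeterministic_iff (f : Hom X Y) : f.IsDeterministic ↔ f.cov = 0 := by
  constructor
  · intro h
    have h1 := congrArg Hom.cov h
    have h2 : ((f.tensor f).comp (copy X)).cov = _ := pair_cov f f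
    rw [h2, copy, wire_comp_cov] at h1
    ext i j
    have h3 := congrFun (congrFun h1 (Sum.inl i)) (Sum.inr j)
    simpa using h3
  · intro h
    have h1 : ((f.tensor f).comp (copy X)).lin = _ := pair_lin f f
    have h2 : ((f.tensor f).comp (copy X)).shift = _ := pair_shift f f
    have h3 : ((f.tensor f).comp (copy X)).cov = _ := pair_cov f f
    apply Hom.ext
    · rw [h1, copy, wire_comp_lin]
      ext (i | i) j <;> simp
    · rw [h2, copy, wire_comp_shift]
      ext (i | i) <;> simp
    · rw [h3, copy, wire_comp_cov]
      ext (i | i) (j | j) <;> simp [h]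

theorem isDeterministic_affine (A : Matrix Y X ℝ) (b : Y → ℝ) : (affine A b).IsDeterministic :=
  (isDeterministic_iff _).2 rfl

theorem IsDeterministic.pair {f : Hom X Y} {g : Hom X Z} (hf : f.IsDeterministic)
    (hg : g.IsDeterministic) : (pair f g).IsDeterministic := by
  rw [isDeterministic_iff] at *
  rw [pair_cov, hf, hg, Matrix.fromBlocks_zero]

theorem state_lin_eq (μ ν : Hom (Fin 0) X) : μ.lin = ν.lin := by
  ext i j
  exact j.elim0

theorem comp_assoc (h : Hom Z W) (g : Hom Y Z) (f : Hom X Y) :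
    (h.comp g).comp f = h.comp (g.comp f) := by
  apply Hom.ext
  · simp [comp, Matrix.mul_assoc]
  · simp [comp, Matrix.mulVec_add, add_assoc]
  · simp [comp, Matrix.mul_add, Matrix.add_mul, Matrix.mul_assoc, add_assoc]

theorem id_comp (f : Hom X Y) : (id Y).comp f = f := by
  apply Hom.ext
  · rw [id, wire_comp_lin]; rfl
  · rw [id, wire_comp_shift]; rfl
  · rw [id, wire_comp_cov]; rfl

theorem wire_inl_comp_pair (f : Hom X Y) (g : Hom X Z) : (wire Sum.inl).comp (pair f g) = f := by
  apply Hom.ext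
  · rw [wire_comp_lin, pair_lin]; ext i j; simp
  · rw [wire_comp_shift, pair_shift]; rfl
  · rw [wire_comp_cov, pair_cov]; ext i j; simp

theorem wire_inr_comp_pair (f : Hom X Y) (g : Hom X Z) : (wire Sum.inr).comp (pair f g) = g := by
  apply Hom.ext
  · rw [wire_comp_lin, pair_lin]; ext i j; simp
  · rw [wire_comp_shift, pair_shift]; rfl
  · rw [wire_comp_cov, pair_cov]; ext i j; simp

theorem swap_comp_pair (f : Hom X Y) (g : Hom X Z) :
    (wire Sum.swap).comp (pair f g) = pair g f := by
  apply Hom.ext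
  · rw [wire_comp_lin, pair_lin, pair_lin]; ext (i | i) j <;> simp
  · rw [wire_comp_shift, pair_shift, pair_shift]; ext (i | i) <;> rfl
  · rw [wire_comp_cov, pair_cov, pair_cov]; ext (i | i) (j | j) <;> simp

theorem conditional_unique {ψ : Hom (Fin 0) (X ⊕ Y)} {κ κ' : Hom Y X} {o : Hom (Fin 0) Y}
    (ho : AbsCont o ψ.margR) (h : IsConditional ψ κ) (h' : IsConditional ψ κ') :
    κ.comp o = κ'.comp o := by
  have e : AsEq ψ.margR κ κ' := by
    unfold IsConditional at h h'
    unfold AsEq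
    rw [← swap_comp_pair κ (id Y), ← swap_comp_pair κ' (id Y), comp_assoc, comp_assoc, ← h, ← h']
  have e' := congrArg (fun t => (wire Sum.inr).comp t) (ho X κ κ' e)
  simpa only [← comp_assoc, wire_inr_comp_pair] using e'

theorem exists_factor {S : Matrix (X ⊕ Y) (X ⊕ Y) ℝ} (hS : S.PosSemidef) :
    ∃ M : Matrix X Y ℝ, M * S.toBlocks₂₂ = S.toBlocks₁₂ := by
  classical
  have row : ∀ i : X, ∃ c : Y → ℝ, ∀ k : Y, ∑ j, c j * S (Sum.inr j) (Sum.inr k) =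
      S (Sum.inl i) (Sum.inr k) := by
    intro i
    let L : Y → (Y → ℝ) →ₗ[ℝ] ℝ := fun j =>
      (LinearMap.proj j).comp (Matrix.mulVecLin S.toBlocks₂₂)
    let Q : (Y → ℝ) →ₗ[ℝ] ℝ := (LinearMap.proj i).comp (Matrix.mulVecLin S.toBlocks₁₂)
    have hLQ : ⨅ j, (L j).ker ≤ Q.ker := by
      intro v hv
      have hv' : S.toBlocks₂₂ *ᵥ v = 0 := by
        ext j
        have := (Submodule.mem_iInf _).1 hv j
        simpa [L] using this
      have h0 : S *ᵥ (Sum.elim 0 v) = 0 := by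
        rw [← hS.dotProduct_mulVec_zero_iff]
        conv_lhs => rw [← Matrix.fromBlocks_toBlocks S]
        simp [Matrix.fromBlocks_mulVec, dotProduct, hv']
      have h1 := congrFun h0 (Sum.inl i)
      rw [← Matrix.fromBlocks_toBlocks S] at h1
      simpa [Matrix.fromBlocks_mulVec, Q] using h1
    obtain ⟨c, hc⟩ := (Submodule.mem_span_range_iff_exists_fun ℝ).1
      (mem_span_of_iInf_ker_le_ker hLQ)
    refine ⟨c, fun k => ?_⟩
    have := LinearMap.congr_fun hc (Pi.single k 1)
    simpa [L, Q, Matrix.toBlocks₂₂, Matrix.toBlocks₁₂] using this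
  choose c hc using row
  refine ⟨Matrix.of c, ?_⟩
  ext i k
  simpa [Matrix.mul_apply, Matrix.toBlocks₂₂, Matrix.toBlocks₁₂] using hc i k

theorem exists_conditional (ψ : Hom (Fin 0) (X ⊕ Y)) : ∃ κ : Hom Y X, IsConditional ψ κ := by
  classical
  obtain ⟨M, hM⟩ := exists_factor ψ.psd
  have hsymm : ψ.covᵀ = ψ.cov := by
    simpa [Matrix.conjTranspose_eq_transpose_of_trivial] using ψ.psd.isHermitian.eq
  have h21 : ψ.cov.toBlocks₂₁ = ψ.cov.toBlocks₁₂ᵀ := by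
    ext i j
    exact congrFun (congrFun hsymm (Sum.inl j)) (Sum.inr i)
  have h22 : ψ.cov.toBlocks₂₂ᵀ = ψ.cov.toBlocks₂₂ := by
    ext i j
    exact congrFun (congrFun hsymm (Sum.inr i)) (Sum.inr j)
  have hM' : ψ.cov.toBlocks₂₂ * Mᵀ = ψ.cov.toBlocks₂₁ := by
    rw [h21, ← hM, Matrix.transpose_mul, h22]
  have hpsd : (ψ.cov.toBlocks₁₁ - M * ψ.cov.toBlocks₂₂ * Mᵀ).PosSemidef := by
    have h := ψ.psd.mul_mul_conjTranspose_same (Matrix.fromCols (1 : Matrix X X ℝ) (-M))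
    rw [Matrix.conjTranspose_eq_transpose_of_trivial, Matrix.transpose_fromCols,
      ← Matrix.fromBlocks_toBlocks ψ.cov, Matrix.fromCols_mul_fromBlocks,
      Matrix.fromCols_mul_fromRows] at h
    convert h using 1
    simp only [Matrix.transpose_one, Matrix.one_mul, Matrix.mul_one, Matrix.neg_mul,
      Matrix.transpose_neg, Matrix.mul_neg, Matrix.add_mul]
    rw [Matrix.mul_assoc M, hM']
    have : ψ.cov.toBlocks₁₂ * Mᵀ = M * ψ.cov.toBlocks₂₁ := by
      rw [← hM, Matrix.mul_assoc, hM']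
    rw [this]
    abel
  refine ⟨⟨M, fun i => ψ.shift (Sum.inl i) - (M *ᵥ fun j => ψ.shift (Sum.inr j)) i, _, hpsd⟩, ?_⟩
  have hid : (id Y).lin = 1 := by
    ext i j
    simp [id, wire, affine, Matrix.one_apply]
  apply Hom.ext
  · exact state_lin_eq _ _
  · have hms : ψ.margR.shift = fun j => ψ.shift (Sum.inr j) := wire_comp_shift _ _
    have hids : (id Y).shift = 0 := rfl
    simp only [comp, pair_lin, pair_shift, hid, hids, hms]
    ext (i | i) <;> simp [Matrix.fromRows_mulVec]
  · have hmr : ψ.margR.cov = ψ.cov.toBlocks₂₂ := wire_comp_cov _ _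
    have hidc : (id Y).cov = 0 := rfl
    simp only [comp, pair_lin, pair_cov, hid, hidc, hmr]
    rw [Matrix.transpose_fromRows, Matrix.fromRows_mul, Matrix.fromRows_mul_fromCols, hM,
      Matrix.transpose_one, Matrix.fromBlocks_add]
    conv_lhs => rw [← Matrix.fromBlocks_toBlocks ψ.cov]
    simp [hM']

end Hom

/-! ## Adding observations -/

/-- A morphism `X ⇝ Y` of `Obs(Gauss)`: an extra output `K`, a Gaussian map `X → Y ⊗ K` and a
deterministic state `obs` of `K`, the observed value of the extra output. -/
structure ObsHom (X Y : Type) : Type 1 where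
  K : Type
  [fin : Fintype K]
  hom : Hom X (Y ⊕ K)
  obs : Hom (Fin 0) K
  det : obs.IsDeterministic

attribute [instance] ObsHom.fin

namespace ObsHom

variable {X Y Z : Type} [Fintype X] [Fintype Y] [Fintype Z]

/-- The functor `J` from Gaussian maps, which observes nothing. -/
noncomputable def J (f : Hom X Y) : ObsHom X Y where
  K := Fin 0
  hom := (Hom.wire (Sum.elim _root_.id Fin.elim0)).comp f
  obs := Hom.affine 0 0
  det := Hom.isDeterministic_affine _ _

/-- Composition `g • f`, which aggregates the observations. -/
noncomputable def comp (g : ObsHom Y Z) (f : ObsHom X Y) : ObsHom X Z where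
  K := g.K ⊕ f.K
  hom := (Hom.wire (Equiv.sumAssoc Z g.K f.K).symm).comp
    ((g.hom.tensor (Hom.id f.K)).comp f.hom)
  obs := Hom.pair g.obs f.obs
  det := g.det.pair f.det

/-- The tensor product `id_A ⊗ f`. -/
noncomputable def whisker (A : Type) [Fintype A] (f : ObsHom X Y) : ObsHom (A ⊕ X) (A ⊕ Y) where
  K := f.K
  hom := (Hom.wire (Equiv.sumAssoc A Y f.K)).comp ((Hom.id A).tensor f.hom)
  obs := f.obs
  det := f.det

/-- The conditioning problem posed by a state succeeds. -/
def Succeeds (ψ : ObsHom (Fin 0) X) : Prop := ψ.obs.AbsCont ψ.hom.margR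

/-- Equivalence `∼` of states: both conditioning problems fail, or both succeed with the same
posterior. -/
def StateEquiv (ψ ψ' : ObsHom (Fin 0) X) : Prop :=
  (ψ.Succeeds ∧ ψ'.Succeeds ∧
    ∃ κ κ', ψ.hom.IsConditional κ ∧ ψ'.hom.IsConditional κ' ∧ κ.comp ψ.obs = κ'.comp ψ'.obs) ∨
  (¬ ψ.Succeeds ∧ ¬ ψ'.Succeeds)

/-- The relation `≈` on morphisms `X ⇝ Y`. -/
def Equivalent (f g : ObsHom X Y) : Prop :=
  ∀ (A : Type) [Fintype A] (ψ : ObsHom (Fin 0) (A ⊕ X)),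
    StateEquiv ((f.whisker A).comp ψ) ((g.whisker A).comp ψ)

theorem StateEquiv.refl (ψ : ObsHom (Fin 0) X) : StateEquiv ψ ψ := by
  by_cases h : ψ.Succeeds
  · obtain ⟨κ, hκ⟩ := ψ.hom.exists_conditional
    exact Or.inl ⟨h, h, κ, κ, hκ, hκ, rfl⟩
  · exact Or.inr ⟨h, h⟩

theorem StateEquiv.symm {ψ φ : ObsHom (Fin 0) X} (h : StateEquiv ψ φ) : StateEquiv φ ψ := by
  rcases h with ⟨h1, h2, κ, κ', hκ, hκ', e⟩ | ⟨h1, h2⟩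
  · exact Or.inl ⟨h2, h1, κ', κ, hκ', hκ, e.symm⟩
  · exact Or.inr ⟨h2, h1⟩

theorem StateEquiv.trans {ψ φ χ : ObsHom (Fin 0) X} (h : StateEquiv ψ φ) (h' : StateEquiv φ χ) :
    StateEquiv ψ χ := by
  rcases h with ⟨h1, h2, κ, κ', hκ, hκ', e⟩ | ⟨h1, h2⟩
  · rcases h' with ⟨h3, h4, l, l', hl, hl', e'⟩ | ⟨h3, h4⟩
    · exact Or.inl ⟨h1, h4, κ, l', hκ, hl',
        e.trans ((Hom.conditional_unique h2 hκ' hl).trans e')⟩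
    · exact absurd h2 h3
  · rcases h' with ⟨h3, h4, l, l', hl, hl', e'⟩ | ⟨h3, h4⟩
    · exact absurd h3 h2
    · exact Or.inr ⟨h1, h4⟩

/-- The equivalence relation `≈` on the morphisms `X ⇝ Y`. -/
def setoid (X Y : Type) [Fintype X] [Fintype Y] : Setoid (ObsHom X Y) where
  r := Equivalent
  iseqv :=
    { refl := fun _ _ _ _ => StateEquiv.refl _
      symm := fun h A _ ψ => (h A ψ).symm
      trans := fun h h' A _ ψ => (h A ψ).trans (h' A ψ) }

end ObsHom

/-- The morphisms `X ⇝ Y` of `Cond(Gauss)`: morphisms of `Obs(Gauss)` modulo `≈`. -/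
def Cond (X Y : Type) [Fintype X] [Fintype Y] : Type 1 := Quotient (ObsHom.setoid X Y)

/-! ## The language -/

/-- Expressions of affine algebra over variables `x_0, …, x_{n-1}`. -/
inductive Val (n : ℕ) : Type
  | var (i : Fin n) : Val n
  | add (s t : Val n) : Val n
  | smul (α : ℝ) (t : Val n) : Val n
  | const (β : ℝ) : Val n

namespace Val

variable {n m : ℕ}

/-- Substitution of expressions for variables. -/
def subst (σ : Fin n → Val m) : Val n → Val m
  | var i => σ i
  | add s t => add (subst σ s) (subst σ t)
  | smul α t => smul α (subst σ t)
  | const β => const β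

/-- `s - t`. -/
def sub (s t : Val n) : Val n := add s (smul (-1) t)

/-- The linear combination `∑ j, c j • x_j`. -/
def linComb (c : Fin n → ℝ) : Val n :=
  (List.ofFn fun j => smul (c j) (var j)).foldr add (const 0)

/-- The coefficients of the affine function denoted by an expression. -/
def coeff : Val n → Fin n → ℝ
  | var i => Pi.single i 1
  | add s t => coeff s + coeff t
  | smul α t => α • coeff t
  | const _ => 0

/-- The constant term of the affine function denoted by an expression. -/
def offset : Val n → ℝ
  | var _ => 0
  | add s t => offset s + offset t
  | smul α t => α * offset t
  | const β => β

/-- The deterministic map `ℝ^n → ℝ^k` denoted by a tuple of `k` expressions. -/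
def denote {k : ℕ} (v : Fin k → Val n) : Hom (Fin n) (Fin k) :=
  Hom.affine (Matrix.of fun i => coeff (v i)) fun i => offset (v i)

/-- Derivability of an equation between expressions over fixed variables `x_0, …, x_{n-1}` from
the equations in `H`, in the theory of pointed vector spaces: real vector spaces (with zero
vector `const 0`) with constants `const β` that obey `α • const β = const (α * β)` and
`const α + const β = const (α + β)`.  The variables are not instantiated in `H`. -/
inductive Entails (H : Val n → Val n → Prop) : Val n → Val n → Prop
  | hyp {s t} : H s t → Entails H s t
  | refl (s) : Entails H s s
  | symm {s t} : Entails H s t → Entails H t s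
  | trans {s t u} : Entails H s t → Entails H t u → Entails H s u
  | add_congr {s s' t t'} : Entails H s s' → Entails H t t' → Entails H (add s t) (add s' t')
  | smul_congr (α) {t t'} : Entails H t t' → Entails H (smul α t) (smul α t')
  | add_comm (s t) : Entails H (add s t) (add t s)
  | add_assoc (s t u) : Entails H (add (add s t) u) (add s (add t u))
  | add_zero (s) : Entails H (add s (const 0)) s
  | add_neg (s) : Entails H (add s (smul (-1) s)) (const 0)
  | one_smul (s) : Entails H (smul 1 s) s
  | mul_smul (α β s) : Entails H (smul (α * β) s) (smul α (smul β s))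
  | smul_add (α s t) : Entails H (smul α (add s t)) (add (smul α s) (smul α t))
  | add_smul (α β s) : Entails H (smul (α + β) s) (add (smul α s) (smul β s))
  | smul_const (α β) : Entails H (smul α (const β)) (const (α * β))
  | const_add (α β) : Entails H (add (const α) (const β)) (const (α + β))

/-- Equality of expressions in the theory of pointed vector spaces. -/
def Eqv (s t : Val n) : Prop := Entails (fun _ _ => False) s t

/-- The equations `s = t` and `s' = t'` are derivable from each other in the theory of pointed
vector spaces. -/
def Interderivable (s t s' t' : Val n) : Prop :=
  Entails (fun u v => u = s ∧ v = t) s' t' ∧ Entails (fun u v => u = s' ∧ v = t') s t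

end Val

/-- Programs with `n` real variables in context and result type `ℝ^k`.  In `nu t`, the bound
variable of `t` is the last one, `Fin.last n`. -/
inductive Prog : ℕ → ℕ → Type
  /-- `let x = normal() in t`, written `ν x. t` -/
  | nu {n k : ℕ} (t : Prog (n + 1) k) : Prog n k
  /-- `(s =:= t); u` -/
  | cond {n k : ℕ} (s t : Val n) (u : Prog n k) : Prog n k
  /-- `return (v_0, …, v_{k-1})`, written `r[v_0, …, v_{k-1}]` -/
  | ret {n k : ℕ} (v : Fin k → Val n) : Prog n k
  /-- failure -/
  | bot {n k : ℕ} : Prog n k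

namespace Prog

/-- A substitution extended to one more bound variable. -/
def lift {n m : ℕ} (σ : Fin n → Val m) : Fin (n + 1) → Val (m + 1) :=
  Fin.snoc (α := fun _ => Val (m + 1))
    (fun i => (σ i).subst fun j => Val.var j.castSucc) (Val.var (Fin.last m))

/-- Capture-avoiding simultaneous substitution of expressions for variables. -/
def subst : {n m k : ℕ} → (Fin n → Val m) → Prog n k → Prog m k
  | _, _, _, σ, nu t => nu (subst (lift σ) t)
  | _, _, _, σ, cond s t u => cond (s.subst σ) (t.subst σ) (subst σ u)
  | _, _, _, σ, ret v => ret fun i => (v i).subst σ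
  | _, _, _, _, bot => bot

/-- The substitution `t[x_1,…,x_m.u/return]`: every `return (v_1, …, v_m)` in `t` is replaced by
`u` with `v_1, …, v_m` for its last `m` variables. -/
def bind : {n m k : ℕ} → Prog n m → Prog (n + m) k → Prog n k
  | n, m, _, nu t, u => nu (bind t (subst (Fin.addCases
      (fun i : Fin n => Val.var (Fin.castAdd m i.castSucc))
      (fun j : Fin m => Val.var (Fin.natAdd (n + 1) j))) u))
  | _, _, _, cond a b t, u => cond a b (bind t u)
  | _, _, _, ret v, u => subst (Fin.addCases Val.var v) u
  | _, _, _, bot, _ => bot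

/-- `ν x_1 … ν x_n. t` as a closed program. -/
def nus {k : ℕ} : (n : ℕ) → Prog n k → Prog 0 k
  | 0, t => t
  | n + 1, t => nus n (nu t)

/-- The Gaussian map `Γ → Γ ⊗ ℝ` that adjoins an independent standard normal variable. -/
noncomputable def sample (n : ℕ) : Hom (Fin n) (Fin (n + 1)) :=
  (Hom.wire finSumFinEquiv.symm).comp
    (((Hom.id (Fin n)).tensor Hom.stdNormal).comp (Hom.wire (Sum.elim _root_.id Fin.elim0)))

/-- The morphism `Γ ⇝ Γ` that observes that `s - t` is `0`: the map `x ↦ (x, s(x) - t(x))`, whose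
second component is the extra output, with observed value `0`. -/
noncomputable def check {n : ℕ} (s t : Val n) : ObsHom (Fin n) (Fin n) where
  K := Fin 1
  hom := Hom.pair (Hom.id (Fin n)) (Val.denote fun _ : Fin 1 => s.sub t)
  obs := Hom.affine 0 0
  det := Hom.isDeterministic_affine _ _

/-- The morphism `ℝ^n ⇝ ℝ^k` that always fails: it deletes its input, produces the output `0`
and observes that a variable which is constantly `0` has the value `1`. -/
noncomputable def fail (n k : ℕ) : ObsHom (Fin n) (Fin k) where
  K := Fin 1
  hom := Hom.affine 0 0
  obs := Hom.affine 0 fun _ => 1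
  det := Hom.isDeterministic_affine _ _

/-- The interpretation of programs by morphisms of `Obs(Gauss)`. -/
noncomputable def interp : {n k : ℕ} → Prog n k → ObsHom (Fin n) (Fin k)
  | n, _, nu t => (interp t).comp (ObsHom.J (sample n))
  | _, _, cond s t u => (interp u).comp (check s t)
  | _, _, ret v => ObsHom.J (Val.denote v)
  | n, k, bot => fail n k

/-- The denotation of a program in `Cond(Gauss)`, i.e. the class of its interpretation (the
quotient map preserves all operations used in the interpretation). -/
noncomputable def denote {n k : ℕ} (t : Prog n k) : Cond (Fin n) (Fin k) :=
  Quotient.mk (ObsHom.setoid (Fin n) (Fin k)) (interp t)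

/-- The program `return ()`. -/
def unit {n : ℕ} : Prog n 0 := ret Fin.elim0

/-- The axioms of the equational theory.  The names `a, b, c, d` of free variables stand for
`x_0, x_1, x_2, x_3`. -/
inductive IsAxiom : {n k : ℕ} → Prog n k → Prog n k → Prop
  /-- `ν x. r[] = r[]` -/
  | DISC : IsAxiom (n := 0) (nu unit) unit
  /-- `ν x⃗. r[U x⃗] = ν x⃗. r[x⃗]` for orthogonal `U` -/
  | ORTH (n : ℕ) (U : Matrix (Fin n) (Fin n) ℝ) (hU : U ∈ Matrix.orthogonalGroup (Fin n) ℝ) :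
      IsAxiom (nus n (ret fun i => Val.linComb (U i))) (nus n (ret Val.var))
  /-- `(a =:= b)(c =:= d) r[] = (c =:= d)(a =:= b) r[]` -/
  | C1 : IsAxiom (n := 4)
      (cond (.var 0) (.var 1) (cond (.var 2) (.var 3) unit))
      (cond (.var 2) (.var 3) (cond (.var 0) (.var 1) unit))
  /-- `(a =:= b) ν x. r[x] = ν x. (a =:= b) r[x]` -/
  | C2 : IsAxiom (n := 2) (k := 1)
      (cond (.var 0) (.var 1) (nu (ret fun _ => .var 2)))
      (nu (cond (.var 0) (.var 1) (ret fun _ => .var 2)))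
  /-- `(a =:= b) ⊥ = ⊥` -/
  | C3 (k : ℕ) : IsAxiom (n := 2) (k := k) (cond (.var 0) (.var 1) bot) bot
  /-- `(a =:= a) r[] = r[]` -/
  | TAUT : IsAxiom (n := 1) (cond (.var 0) (.var 0) unit) unit
  /-- `(0 =:= 1) r[] = ⊥` -/
  | FAIL : IsAxiom (n := 0) (cond (.const 0) (.const 1) unit) bot
  /-- `(a =:= b) r[a] = (a =:= b) r[b]` -/
  | SUBS : IsAxiom (n := 2) (k := 1)
      (cond (.var 0) (.var 1) (ret fun _ => .var 0))
      (cond (.var 0) (.var 1) (ret fun _ => .var 1))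
  /-- `ν x. (x =:= c) r[x] = r[c]` -/
  | INIT (c : ℝ) : IsAxiom (n := 0) (k := 1)
      (nu (cond (.var 0) (.const c) (ret fun _ => .var 0)))
      (ret fun _ => .const c)
  /-- `(s =:= t) r[] = (s' =:= t') r[]` if `s = t` and `s' = t'` are interderivable -/
  | CONG {n : ℕ} (s t s' t' : Val n) (h : Val.Interderivable s t s' t') :
      IsAxiom (cond s t unit) (cond s' t' unit)

/-- Derivable equality of programs: the congruence generated by the axioms, over the theory of
pointed vector spaces for expressions, closed under both forms of substitution. -/
inductive Derivable : {n k : ℕ} → Prog n k → Prog n k → Prop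
  | ax {n k : ℕ} {t u : Prog n k} : IsAxiom t u → Derivable t u
  | refl {n k : ℕ} (t : Prog n k) : Derivable t t
  | symm {n k : ℕ} {t u : Prog n k} : Derivable t u → Derivable u t
  | trans {n k : ℕ} {t u v : Prog n k} : Derivable t u → Derivable u v → Derivable t v
  | nu_congr {n k : ℕ} {t t' : Prog (n + 1) k} : Derivable t t' → Derivable (nu t) (nu t')
  | cond_congr {n k : ℕ} {s s' t t' : Val n} {u u' : Prog n k} :
      s.Eqv s' → t.Eqv t' → Derivable u u' → Derivable (cond s t u) (cond s' t' u')
  | ret_congr {n k : ℕ} {v v' : Fin k → Val n} :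
      (∀ i, (v i).Eqv (v' i)) → Derivable (ret v) (ret v')
  | subst {n m k : ℕ} (σ : Fin n → Val m) {t t' : Prog n k} :
      Derivable t t' → Derivable (subst σ t) (subst σ t')
  | bind {n m k : ℕ} {t t' : Prog n m} {u u' : Prog (n + m) k} :
      Derivable t t' → Derivable u u' → Derivable (bind t u) (bind t' u')

end Prog

end CondGauss

namespace CondGauss

open scoped Matrix

/-! The relation `∼` on states is replaced by one that is easy to compute. For a state with extra
output `K` observed to be `o`, consider the infimum over functionals `u` on `K` of `cum (w, u) - u ·
o`, where `cum` is the log-Laplace transform of the joint Gaussian. If the observation is possible,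
completing the square shows that the infimum is attained and equals the log-Laplace transform of the
posterior at `w`, up to a constant independent of `w`. If it is impossible, the expression is
unbounded below for every `w`. Hence two states are equivalent iff these functions of `w` agree up
to an additive constant (`stateEquiv_iff`). Recording the set of upper bounds `r` instead of the
infimum avoids the value minus infinity and turns minimization into an existential quantifier.

Morphisms act on potentials functorially (`ObsHom.push_comp`), and an extra system `A` is a mere
parameter (`push_whisker`). So two morphisms are equal in `Cond(Gauss)` iff their actions on
potentials of states agree up to a constant that does not depend on the parameter
(`equivalent_iff`).

On potentials, sampling subtracts half a square from the bound, conditioning on `s = t` is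
minimization along the line spanned by `s - t`, returning is precomposition with the transposed map,
and failure gives everything. Each axiom becomes elementary algebra; only (INIT) needs a nonzero
constant. The congruence rules follow by testing the hypothesis on a suitably extended state, with
`sem_subst` and `sem_bind` describing the two substitutions. Consistency holds because the potential
of a successful state is not everything. -/

/-- A potential on `X`: a family of sets of real numbers, indexed by the linear functionals on
`ℝ^X`.  The potential of a state is the epigraph of its logarithmic Laplace transform, minimized
over the functionals on the observed output. -/
abbrev Pot (X : Type) : Type := (X → ℝ) → ℝ → Prop

/-- The potentials `e` and `e'` agree up to an additive constant. -/
def Pot.ShiftEq {X : Type} (e e' : Pot X) : Prop := ∃ c : ℝ, ∀ w r, e w r ↔ e' w (r + c)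

/-! ### Gaussian maps acting on potentials. -/

namespace Hom

variable {X Y Z W : Type} [Fintype X] [Fintype Y] [Fintype Z] [Fintype W]

/-- The logarithmic Laplace transform of the noise `b + 𝒩(Σ)` of a Gaussian map. -/
noncomputable def cum (h : Hom X Y) (v : Y → ℝ) : ℝ :=
  v ⬝ᵥ h.shift + (v ⬝ᵥ h.cov *ᵥ v) / 2

/-- The transformation of potentials by a Gaussian map. -/
def push (h : Hom X Y) (e : Pot X) : Pot Y := fun v r => e (v ᵥ* h.lin) (r - h.cum v)

theorem dotProduct_conj_mulVec (A : Matrix Y X ℝ) (S : Matrix X X ℝ) (v : Y → ℝ) :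
    v ⬝ᵥ (A * S * Aᵀ) *ᵥ v = (v ᵥ* A) ⬝ᵥ S *ᵥ (v ᵥ* A) := by
  rw [← Matrix.mulVec_mulVec, ← Matrix.mulVec_mulVec, Matrix.dotProduct_mulVec,
    Matrix.mulVec_transpose]

/-- The two noises are independent, so their log-Laplace transforms add once `v` is pulled back
along the linear part of `g`. This makes `push` functorial. -/
theorem cum_comp (g : Hom Y Z) (f : Hom X Y) (v : Z → ℝ) :
    (g.comp f).cum v = g.cum v + f.cum (v ᵥ* g.lin) := by
  simp only [cum, comp, Matrix.add_mulVec, dotProduct_add, dotProduct_conj_mulVec,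
    Matrix.dotProduct_mulVec v g.lin]
  ring

theorem push_comp (g : Hom Y Z) (f : Hom X Y) (e : Pot X) :
    (g.comp f).push e = g.push (f.push e) := by
  funext v r
  simp only [push, cum_comp, sub_sub]
  simp [comp, Matrix.vecMul_vecMul]

theorem cum_affine (A : Matrix Y X ℝ) (b : Y → ℝ) (v : Y → ℝ) :
    (affine A b).cum v = v ⬝ᵥ b := by
  simp [cum, affine]

theorem cum_wire (w : Y → X) (v : Y → ℝ) : (wire w : Hom X Y).cum v = 0 := by
  simp [wire, cum_affine]

theorem vecMul_wire_lin [DecidableEq X] (w : Y → X) (v : Y → ℝ) (i : X) :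
    (v ᵥ* (wire w : Hom X Y).lin) i = ∑ j, v j * (Pi.single (w j) 1 : X → ℝ) i := by
  simp [wire, affine, Matrix.vecMul, dotProduct, Pi.single_apply, eq_comm]

theorem push_wire (w : Y → X) (e : Pot X) (v : Y → ℝ) (r : ℝ) :
    (wire w : Hom X Y).push e v r ↔ e (v ᵥ* (wire w : Hom X Y).lin) r := by
  simp [push, cum_wire]

theorem vecMul_wire_equiv (w : Y ≃ X) (v : Y → ℝ) :
    v ᵥ* (wire w : Hom X Y).lin = v ∘ w.symm := by
  classical
  ext i
  simp [vecMul_wire_lin, Pi.single_apply, ← Equiv.symm_apply_eq]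

theorem vecMul_wire_elim_id (v : X → ℝ) (u : Fin 0 → ℝ) :
    (Sum.elim v u) ᵥ* (wire (Sum.elim _root_.id Fin.elim0) : Hom X (X ⊕ Fin 0)).lin = v := by
  classical
  ext i
  simp only [vecMul_wire_lin, Fintype.sum_sum_type, Sum.elim_inl, id_eq]
  simp [Pi.single_apply]

theorem vecMul_wire_elim_inr (a : X → ℝ) (x y : Y → ℝ) :
    (Sum.elim (Sum.elim a x) y) ᵥ*
      (wire (Sum.elim _root_.id Sum.inr) : Hom (X ⊕ Y) ((X ⊕ Y) ⊕ Y)).lin =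
        Sum.elim a (y + x) := by
  classical
  ext (i | i) <;> simp [vecMul_wire_lin, Pi.single_apply, add_comm]

theorem id_lin [DecidableEq X] : (id X).lin = 1 := by
  ext i j
  simp [id, wire, affine, Matrix.one_apply]

theorem vecMul_id_lin (v : X → ℝ) : v ᵥ* (id X).lin = v :=
  vecMul_wire_equiv (Equiv.refl X) v

theorem cum_id (v : X → ℝ) : (id X).cum v = 0 := cum_wire _ v

theorem push_tensor (f : Hom X Y) (g : Hom Z W) (e : Pot (X ⊕ Z)) (a : Y → ℝ) (b : W → ℝ)
    (r : ℝ) : (f.tensor g).push e (Sum.elim a b) r ↔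
      e (Sum.elim (a ᵥ* f.lin) (b ᵥ* g.lin)) (r - (f.cum a + g.cum b)) := by
  have h : (f.tensor g).cum (Sum.elim a b) = f.cum a + g.cum b := by
    simp only [cum, tensor, Matrix.fromBlocks_mulVec, sumElim_dotProduct_sumElim]
    simp
    ring
  simp only [push, h]
  simp [tensor, Matrix.vecMul_fromBlocks]

/-- Copying is dual to addition of functionals, whence the sum of the two pullbacks. -/
theorem push_pair (f : Hom X Y) (g : Hom X Z) (e : Pot X) (a : Y → ℝ) (b : Z → ℝ)
    (r : ℝ) : (pair f g).push e (Sum.elim a b) r ↔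
      e (a ᵥ* f.lin + b ᵥ* g.lin) (r - (f.cum a + g.cum b)) := by
  have h : (pair f g).cum (Sum.elim a b) = f.cum a + g.cum b := by
    simp only [cum, pair_shift, pair_cov, Matrix.fromBlocks_mulVec, sumElim_dotProduct_sumElim]
    simp
    ring
  simp only [push, h, pair_lin, Matrix.sumElim_vecMul_fromRows]

/-! ### Absolute continuity -/

theorem transpose_cov (h : Hom X Y) : h.covᵀ = h.cov := by
  simpa [Matrix.conjTranspose_eq_transpose_of_trivial] using h.psd.isHermitian.eq

theorem pair_comp_cov (f : Hom X Y) (g : Hom X Z) (μ : Hom W X) : ((pair f g).comp μ).cov =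
    Matrix.fromBlocks (f.lin * μ.cov * f.linᵀ + f.cov) (f.lin * μ.cov * g.linᵀ)
      (g.lin * μ.cov * f.linᵀ) (g.lin * μ.cov * g.linᵀ + g.cov) := by
  simp only [comp, pair_lin, pair_cov]
  rw [Matrix.transpose_fromRows, Matrix.fromRows_mul, Matrix.fromRows_mul_fromCols,
    Matrix.fromBlocks_add, add_zero, add_zero]

/-- If `v` is in the kernel of the covariance, then `x ↦ v · x` is `μ`-almost surely equal to the
constant `v · μ.shift`. Absolute continuity, tested on these two maps to `ℝ`, transfers the equality
to `o`. -/
theorem AbsCont.dotProduct_eq_zero {o μ : Hom (Fin 0) X} (h : AbsCont o μ) {v : X → ℝ}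
    (hv : μ.cov *ᵥ v = 0) : v ⬝ᵥ (o.shift - μ.shift) = 0 := by
  have hrow : Matrix.replicateRow (Fin 1) v * μ.cov = 0 := by
    ext i j
    have := congrFun hv j
    rw [← transpose_cov μ, Matrix.mulVec_transpose] at this
    simpa [Matrix.mul_apply, Matrix.vecMul, dotProduct] using this
  have hcol : μ.cov * (Matrix.replicateRow (Fin 1) v)ᵀ = 0 := by
    rw [← Matrix.transpose_inj, Matrix.transpose_mul, transpose_cov]
    simpa using hrow
  classical
  have key := h (Fin 1) (affine (Matrix.replicateRow (Fin 1) v) 0)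
    (affine 0 fun _ => v ⬝ᵥ μ.shift) (by
      apply Hom.ext
      · exact state_lin_eq _ _
      · simp only [comp, pair_lin, pair_shift, affine]
        ext (i | i) <;> simp [Matrix.fromRows_mulVec, Matrix.mulVec]
      · simp [pair_comp_cov, affine, id_lin, hrow]
        simpa using hcol)
  have := congrFun (congrArg Hom.shift key) (Sum.inr 0)
  simp only [comp, pair_lin, pair_shift, affine] at this
  simp only [Matrix.fromRows_mulVec, Pi.add_apply, Sum.elim_inr] at this
  rw [dotProduct_sub, sub_eq_zero]
  simpa [Matrix.mulVec] using this

/-- A functional that vanishes on the common kernel of the rows of `S` is a linear combination of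
the rows. -/
theorem exists_mulVec_eq {S : Matrix X X ℝ} {d : X → ℝ}
    (h : ∀ v, S *ᵥ v = 0 → v ⬝ᵥ d = 0) : ∃ c, c ᵥ* S = d := by
  classical
  let L : X → (X → ℝ) →ₗ[ℝ] ℝ := fun j => (LinearMap.proj j).comp (Matrix.mulVecLin S)
  let Q : (X → ℝ) →ₗ[ℝ] ℝ := dotProductBilin ℝ ℝ d
  have hLQ : ⨅ j, (L j).ker ≤ Q.ker := by
    intro v hv
    have hv' : S *ᵥ v = 0 := by
      ext j
      have := (Submodule.mem_iInf _).1 hv j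
      simpa [L] using this
    have := h v hv'
    rw [dotProduct_comm] at this
    simpa [Q] using this
  obtain ⟨c, hc⟩ := (Submodule.mem_span_range_iff_exists_fun ℝ).1
    (mem_span_of_iInf_ker_le_ker hLQ)
  refine ⟨c, ?_⟩
  ext k
  have := LinearMap.congr_fun hc (Pi.single k 1)
  simpa [L, Q, Matrix.vecMul, dotProduct, Pi.single_apply] using this

/-- Almost sure equality of `f` and `g` forces equal noise, equal images of the mean and, through
the cross-covariance with the identity, linear parts that agree on the range of the covariance. The
displacement from the mean to `o` lies in this range. -/
theorem absCont_of_mulVec_eq {o μ : Hom (Fin 0) X} (ho : o.cov = 0) {v : X → ℝ}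
    (hv : μ.cov *ᵥ v = o.shift - μ.shift) : AbsCont o μ := by
  intro Y _ f g h
  have hs := congrArg Hom.shift h
  have hc := congrArg Hom.cov h
  classical
  simp only [comp, pair_lin, pair_shift, Matrix.fromRows_mulVec] at hs
  rw [pair_comp_cov, pair_comp_cov, Matrix.fromBlocks_inj] at hc
  obtain ⟨-, -, h21, h22⟩ := hc
  simp only [id_lin, Matrix.transpose_one, Matrix.mul_one] at h21
  have h3 : f.lin * μ.cov * f.linᵀ = g.lin * μ.cov * g.linᵀ := by
    have e : μ.cov * f.linᵀ = μ.cov * g.linᵀ := by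
      have := congrArg Matrix.transpose h21
      simpa [Matrix.transpose_mul, transpose_cov] using this
    rw [h21, Matrix.mul_assoc, e, Matrix.mul_assoc]
  have hcov : f.cov = g.cov := by
    rw [h3] at h22
    exact add_left_cancel h22
  have hsh : f.lin *ᵥ μ.shift + f.shift = g.lin *ᵥ μ.shift + g.shift := by
    ext i
    have := congrFun hs (Sum.inr i)
    simpa using this
  have hlin : f.lin *ᵥ (o.shift - μ.shift) = g.lin *ᵥ (o.shift - μ.shift) := by
    rw [← hv, Matrix.mulVec_mulVec, Matrix.mulVec_mulVec, h21]
  apply Hom.ext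
  · exact state_lin_eq _ _
  · simp only [comp, pair_lin, pair_shift, Matrix.fromRows_mulVec]
    have : f.lin *ᵥ o.shift + f.shift = g.lin *ᵥ o.shift + g.shift := by
      rw [Matrix.mulVec_sub, Matrix.mulVec_sub] at hlin
      ext i
      have a := congrFun hsh i
      have b := congrFun hlin i
      simp only [Pi.add_apply, Pi.sub_apply] at a b ⊢
      linarith
    ext (i | i)
    · rfl
    · simpa using congrFun this i
  · simp only [comp, pair_cov, ho, hcov]
    simp

theorem absCont_iff {o μ : Hom (Fin 0) X} (ho : o.cov = 0) :
    AbsCont o μ ↔ ∃ v, μ.cov *ᵥ v = o.shift - μ.shift := by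
  refine ⟨fun h => ?_, fun ⟨v, hv⟩ => absCont_of_mulVec_eq ho hv⟩
  obtain ⟨c, hc⟩ := exists_mulVec_eq fun v hv => h.dotProduct_eq_zero (v := v) hv
  exact ⟨c, by rw [← hc, ← Matrix.mulVec_transpose, transpose_cov]⟩

/-- Comparing `w` with `-w` separates the mean from the quadratic form, and polarization recovers
the covariance. -/
theorem ext_of_cum {μ ν : Hom (Fin 0) X} (h : ∀ w, μ.cum w = ν.cum w) : μ = ν := by
  classical
  have hq : ∀ w, w ⬝ᵥ μ.shift = w ⬝ᵥ ν.shift ∧ w ⬝ᵥ μ.cov *ᵥ w = w ⬝ᵥ ν.cov *ᵥ w := by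
    intro w
    have h1 := h w
    have h2 := h (-w)
    simp only [cum, neg_dotProduct, Matrix.mulVec_neg, dotProduct_neg] at h1 h2
    constructor <;> linarith
  apply Hom.ext
  · exact state_lin_eq _ _
  · ext i
    simpa using (hq (Pi.single i 1)).1
  · ext i j
    have hi := (hq (Pi.single i 1)).2
    have hj := (hq (Pi.single j 1)).2
    have hij := (hq (Pi.single i 1 + Pi.single j 1)).2
    have sμ : μ.cov j i = μ.cov i j := congrFun (congrFun (transpose_cov μ) i) j
    have sν : ν.cov j i = ν.cov i j := congrFun (congrFun (transpose_cov ν) i) j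
    simp [Matrix.mulVec_add, add_dotProduct, sμ, sν] at hi hj hij
    linarith

/-- The transformation of potentials by a Gaussian map whose extra output is observed to be
`o`. -/
def observe (h : Hom X (Y ⊕ Z)) (o : Z → ℝ) (e : Pot X) : Pot Y := fun w r =>
  ∃ u : Z → ℝ, h.push e (Sum.elim w u) (r + u ⬝ᵥ o)

end Hom

/-! ### Morphisms with observations acting on potentials. -/

namespace ObsHom

variable {X Y Z : Type} [Fintype X] [Fintype Y] [Fintype Z]

/-- The transformation of potentials by a morphism of `Obs(Gauss)`. -/
def push (f : ObsHom X Y) (e : Pot X) : Pot Y := f.hom.observe f.obs.shift e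

theorem push_J (f : Hom X Y) (e : Pot X) : (J f).push e = f.push e := by
  change Hom.observe (Z := Fin 0) ((Hom.wire (Sum.elim _root_.id Fin.elim0)).comp f) 0 e = _
  funext w r
  simp [Hom.observe, Hom.push_comp, Hom.push_wire, Hom.vecMul_wire_elim_id]

/-- Observations are aggregated, so the existential over functionals on `g.K ⊕ f.K` splits into two
nested ones. -/
theorem push_comp (g : ObsHom Y Z) (f : ObsHom X Y) (e : Pot X) :
    (g.comp f).push e = g.push (f.push e) := by
  change Hom.observe (Z := g.K ⊕ f.K) ((Hom.wire (Equiv.sumAssoc Z g.K f.K).symm).comp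
    ((g.hom.tensor (Hom.id f.K)).comp f.hom)) (Hom.pair g.obs f.obs).shift e = _
  funext w r
  have h : ∀ (u : g.K → ℝ) (v : f.K → ℝ),
      ((Hom.wire (Equiv.sumAssoc Z g.K f.K).symm).comp
        ((g.hom.tensor (Hom.id f.K)).comp f.hom)).push e (Sum.elim w (Sum.elim u v))
        (r + (Sum.elim u v) ⬝ᵥ (Hom.pair g.obs f.obs).shift) ↔
      f.hom.push e (Sum.elim ((Sum.elim w u) ᵥ* g.hom.lin) v)
        (r + u ⬝ᵥ g.obs.shift - g.hom.cum (Sum.elim w u) + v ⬝ᵥ f.obs.shift) := by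
    intro u v
    have h1 : (Sum.elim w (Sum.elim u v)) ∘ (Equiv.sumAssoc Z g.K f.K) =
        Sum.elim (Sum.elim w u) v := by
      ext ((i | i) | i) <;> rfl
    rw [Hom.pair_shift, sumElim_dotProduct_sumElim, Hom.push_comp, Hom.push_comp, Hom.push_wire,
      Hom.vecMul_wire_equiv, Equiv.symm_symm, h1, Hom.push_tensor, Hom.vecMul_id_lin, Hom.cum_id]
    ring_nf
  apply propext
  constructor
  · rintro ⟨u, hu⟩
    refine ⟨fun i => u (Sum.inl i), fun i => u (Sum.inr i), (h _ _).1 ?_⟩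
    rwa [show Sum.elim (fun i => u (Sum.inl i)) (fun i => u (Sum.inr i)) = u from
      Sum.elim_comp_inl_inr u]
  · rintro ⟨u, v, huv⟩
    exact ⟨Sum.elim u v, (h u v).2 huv⟩

theorem push_whisker {A : Type} [Fintype A] (f : ObsHom X Y) (e : Pot (A ⊕ X)) (a : A → ℝ)
    (w : Y → ℝ) (r : ℝ) : (f.whisker A).push e (Sum.elim a w) r ↔
      f.push (fun x => e (Sum.elim a x)) w r := by
  change Hom.observe (Z := f.K) ((Hom.wire (Equiv.sumAssoc A Y f.K)).comp
    ((Hom.id A).tensor f.hom)) f.obs.shift e _ _ ↔ _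
  refine exists_congr fun u => ?_
  have h1 : (Sum.elim (Sum.elim a w) u) ∘ (Equiv.sumAssoc A Y f.K).symm =
      Sum.elim a (Sum.elim w u) := by
    ext (i | i | i) <;> rfl
  rw [Hom.push_comp, Hom.push_wire, Hom.vecMul_wire_equiv, h1, Hom.push_tensor, Hom.vecMul_id_lin,
    Hom.cum_id, zero_add]
  rfl

/-- The potential of a state. -/
def pot (ψ : ObsHom (Fin 0) X) : Pot X := ψ.push fun _ r => 0 ≤ r

theorem pot_comp (f : ObsHom X Y) (ψ : ObsHom (Fin 0) X) : (f.comp ψ).pot = f.push ψ.pot :=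
  push_comp _ _ _

theorem pot_whisker_comp {A : Type} [Fintype A] (f : ObsHom X Y) (ψ : ObsHom (Fin 0) (A ⊕ X))
    (a : A → ℝ) (w : Y → ℝ) (r : ℝ) : ((f.whisker A).comp ψ).pot (Sum.elim a w) r ↔
      f.push (fun x => ψ.pot (Sum.elim a x)) w r := by
  rw [pot_comp, push_whisker]

theorem pot_nonempty (ψ : ObsHom (Fin 0) X) (w : X → ℝ) : ∃ r, ψ.pot w r :=
  ⟨ψ.hom.cum (Sum.elim w 0), 0, by simp [Hom.push]⟩

theorem pot_mono (ψ : ObsHom (Fin 0) X) {w : X → ℝ} {r r' : ℝ} (h : r ≤ r') :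
    ψ.pot w r → ψ.pot w r' := by
  rintro ⟨u, hu⟩
  refine ⟨u, ?_⟩
  simp only [Hom.push] at hu ⊢
  linarith

theorem push_shift (f : ObsHom X Y) {e e' : Pot X} {c : ℝ} (h : ∀ w r, e w r ↔ e' w (r + c))
    (w : Y → ℝ) (r : ℝ) : f.push e w r ↔ f.push e' w (r + c) := by
  refine exists_congr fun u => ?_
  simp only [Hom.push]
  rw [h]
  ring_nf

/-! ### The equivalence of states in terms of potentials -/

/-- Disintegrate the joint state along `κ` and substitute `v = w ᵥ* κ.lin + u`. The expression to be
minimized then decouples into a quadratic in `v` alone, which decides success, and the transform of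
the posterior at `w`. -/
theorem pot_iff {ψ : ObsHom (Fin 0) X} {κ : Hom ψ.K X} (hκ : ψ.hom.IsConditional κ)
    (w : X → ℝ) (r : ℝ) : ψ.pot w r ↔ ∃ v : ψ.K → ℝ,
      v ⬝ᵥ (ψ.hom.margR.shift - ψ.obs.shift) + (v ⬝ᵥ ψ.hom.margR.cov *ᵥ v) / 2 +
        (κ.comp ψ.obs).cum w ≤ r := by
  have ho : ψ.obs.cov = 0 := (Hom.isDeterministic_iff _).1 ψ.det
  have key : ∀ u : ψ.K → ℝ, ψ.hom.push (fun _ r => 0 ≤ r) (Sum.elim w u)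
      (r + u ⬝ᵥ ψ.obs.shift) ↔
      (w ᵥ* κ.lin + u) ⬝ᵥ (ψ.hom.margR.shift - ψ.obs.shift) +
        ((w ᵥ* κ.lin + u) ⬝ᵥ ψ.hom.margR.cov *ᵥ (w ᵥ* κ.lin + u)) / 2 +
        (κ.comp ψ.obs).cum w ≤ r := by
    intro u
    have e := hκ
    unfold Hom.IsConditional at e
    -- The marginal is itself built from `ψ.hom`; abstracting it keeps the rewriting by `e` from
    -- unfolding it again.
    generalize ψ.hom.margR = μ at *
    rw [e, Hom.push_comp, Hom.push_pair, Hom.vecMul_id_lin, Hom.cum_id, Hom.cum_comp]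
    simp only [Hom.push, Hom.cum, ho, dotProduct_sub, add_dotProduct]
    simp only [Matrix.zero_mulVec, dotProduct_zero]
    rw [← sub_nonneg (b := _ + _)]
    apply iff_of_eq
    congr 1
    ring
  constructor
  · rintro ⟨u, hu⟩
    exact ⟨_, (key u).1 hu⟩
  · rintro ⟨v, hv⟩
    refine ⟨v - w ᵥ* κ.lin, (key _).2 ?_⟩
    simpa using hv

/-- Complete the square: a preimage `v` of the displacement under the covariance minimizes the
quadratic of `pot_iff`, and the minimum does not depend on `w`. -/
theorem pot_of_succeeds {ψ : ObsHom (Fin 0) X} (h : ψ.Succeeds) {κ : Hom ψ.K X}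
    (hκ : ψ.hom.IsConditional κ) :
    ∃ c : ℝ, ∀ w r, ψ.pot w r ↔ (κ.comp ψ.obs).cum w ≤ r + c := by
  obtain ⟨v, hv⟩ := (Hom.absCont_iff ((Hom.isDeterministic_iff _).1 ψ.det)).1 h
  have hq : ∀ u : ψ.K → ℝ,
      u ⬝ᵥ (ψ.hom.margR.shift - ψ.obs.shift) + (u ⬝ᵥ ψ.hom.margR.cov *ᵥ u) / 2 =
      ((u - v) ⬝ᵥ ψ.hom.margR.cov *ᵥ (u - v)) / 2 - (v ⬝ᵥ ψ.hom.margR.cov *ᵥ v) / 2 := by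
    intro u
    have hs : v ⬝ᵥ ψ.hom.margR.cov *ᵥ u = u ⬝ᵥ ψ.hom.margR.cov *ᵥ v := by
      rw [Matrix.dotProduct_mulVec, dotProduct_comm, ← Matrix.mulVec_transpose, Hom.transpose_cov]
    rw [← neg_sub ψ.obs.shift, ← hv, Matrix.mulVec_sub]
    simp only [sub_dotProduct, dotProduct_sub, hs, dotProduct_neg]
    ring
  refine ⟨(v ⬝ᵥ ψ.hom.margR.cov *ᵥ v) / 2, fun w r => ?_⟩
  rw [pot_iff hκ]
  constructor
  · rintro ⟨u, hu⟩
    rw [hq] at hu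
    have := ψ.hom.margR.psd.dotProduct_mulVec_nonneg (u - v)
    simp only [star_trivial] at this
    linarith
  · intro hw
    refine ⟨v, ?_⟩
    rw [hq]
    simp
    linarith

/-- Failure yields a direction in the kernel of the covariance along which the linear term does not
vanish. On that line the quadratic is linear and takes every value. -/
theorem pot_of_not_succeeds {ψ : ObsHom (Fin 0) X} (h : ¬ ψ.Succeeds) (w : X → ℝ) (r : ℝ) :
    ψ.pot w r := by
  obtain ⟨κ, hκ⟩ := ψ.hom.exists_conditional
  rw [pot_iff hκ]
  have : ∃ v, ψ.hom.margR.cov *ᵥ v = 0 ∧ v ⬝ᵥ (ψ.hom.margR.shift - ψ.obs.shift) ≠ 0 := by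
    by_contra! hcon
    obtain ⟨c, hc⟩ := Hom.exists_mulVec_eq hcon
    refine h ((Hom.absCont_iff ((Hom.isDeterministic_iff _).1 ψ.det)).2 ⟨-c, ?_⟩)
    rw [Matrix.mulVec_neg, ← neg_sub ψ.hom.margR.shift, ← hc, ← Matrix.mulVec_transpose,
      Hom.transpose_cov]
  obtain ⟨v, hv, hne⟩ := this
  refine ⟨((r - (κ.comp ψ.obs).cum w) / (v ⬝ᵥ (ψ.hom.margR.shift - ψ.obs.shift))) • v, ?_⟩
  rw [Matrix.mulVec_smul, hv, smul_dotProduct, smul_eq_mul, div_mul_cancel₀ _ hne]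
  simp

theorem exists_not_pot_of_succeeds {ψ : ObsHom (Fin 0) X} (h : ψ.Succeeds) (w : X → ℝ) :
    ∃ r, ¬ ψ.pot w r := by
  obtain ⟨κ, hκ⟩ := ψ.hom.exists_conditional
  obtain ⟨c, hc⟩ := pot_of_succeeds h hκ
  refine ⟨(κ.comp ψ.obs).cum w - c - 1, fun hp => ?_⟩
  rw [hc] at hp
  linarith

theorem stateEquiv_iff {ψ φ : ObsHom (Fin 0) X} :
    StateEquiv ψ φ ↔ Pot.ShiftEq ψ.pot φ.pot := by
  constructor
  · rintro (⟨h, h', κ, κ', hκ, hκ', e⟩ | ⟨h, h'⟩)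
    · obtain ⟨c, hc⟩ := pot_of_succeeds h hκ
      obtain ⟨c', hc'⟩ := pot_of_succeeds h' hκ'
      refine ⟨c - c', fun w r => ?_⟩
      rw [hc, hc', e]
      ring_nf
    · exact ⟨0, fun w r => iff_of_true (pot_of_not_succeeds h _ _) (pot_of_not_succeeds h' _ _)⟩
  · rintro ⟨d, hd⟩
    by_cases h : ψ.Succeeds <;> by_cases h' : φ.Succeeds
    · obtain ⟨κ, hκ⟩ := ψ.hom.exists_conditional
      obtain ⟨κ', hκ'⟩ := φ.hom.exists_conditional
      obtain ⟨c, hc⟩ := pot_of_succeeds h hκ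
      obtain ⟨c', hc'⟩ := pot_of_succeeds h' hκ'
      refine Or.inl ⟨h, h', κ, κ', hκ, hκ', Hom.ext_of_cum ?_⟩
      have hle : ∀ w r, (κ.comp ψ.obs).cum w ≤ r ↔
          (κ'.comp φ.obs).cum w ≤ r + (d + c' - c) := by
        intro w r
        have := hd w (r - c)
        rw [hc, hc'] at this
        rw [sub_add_cancel] at this
        rw [this]
        ring_nf
      have h1 : ∀ w, (κ'.comp φ.obs).cum w = (κ.comp ψ.obs).cum w + (d + c' - c) := by
        intro w
        apply le_antisymm ((hle w _).1 le_rfl)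
        have := (hle w ((κ'.comp φ.obs).cum w - (d + c' - c))).2 (by simp)
        linarith
      -- Both transforms vanish at `0`, so the additive constant between the two posteriors is `0`.
      have h0 := h1 0
      simp only [Hom.cum, zero_dotProduct] at h0
      intro w
      rw [h1 w]
      linarith
    · obtain ⟨r, hr⟩ := exists_not_pot_of_succeeds h 0
      exact absurd ((hd 0 r).2 (pot_of_not_succeeds h' _ _)) hr
    · obtain ⟨r, hr⟩ := exists_not_pot_of_succeeds h' 0
      refine absurd ?_ hr
      have := (hd 0 (r - d)).1 (pot_of_not_succeeds h _ _)
      rwa [sub_add_cancel] at this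
    · exact Or.inr ⟨h, h'⟩

/-- The constant is chosen before `a`. This uniformity is what the soundness of `bind` relies on. -/
theorem equivalent_iff {f g : ObsHom X Y} : Equivalent f g ↔
    ∀ (A : Type) [Fintype A] (ψ : ObsHom (Fin 0) (A ⊕ X)), ∃ c : ℝ, ∀ (a : A → ℝ) w r,
      f.push (fun x => ψ.pot (Sum.elim a x)) w r ↔
        g.push (fun x => ψ.pot (Sum.elim a x)) w (r + c) := by
  refine forall_congr' fun A => forall_congr' fun _ => forall_congr' fun ψ => ?_
  rw [stateEquiv_iff]
  refine exists_congr fun c => ⟨fun h a w r => ?_, fun h w r => ?_⟩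
  · rw [← pot_whisker_comp, ← pot_whisker_comp, h]
  · rw [← Sum.elim_comp_inl_inr w, pot_whisker_comp, pot_whisker_comp, h]

end ObsHom
-- Expressions as affine functions.
namespace Val

variable {n m : ℕ}

theorem coeff_subst (σ : Fin n → Val m) (s : Val n) :
    (s.subst σ).coeff = s.coeff ᵥ* Matrix.of fun i => (σ i).coeff := by
  induction s with
  | var i => simp [subst, coeff]
  | add s t hs ht => simp [subst, coeff, hs, ht, Matrix.add_vecMul]
  | smul α t ht => simp [subst, coeff, ht, Matrix.smul_vecMul]
  | const β => simp [subst, coeff]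

theorem offset_subst (σ : Fin n → Val m) (s : Val n) :
    (s.subst σ).offset = s.coeff ⬝ᵥ (fun i => (σ i).offset) + s.offset := by
  induction s with
  | var i => simp [subst, coeff, offset]
  | add s t hs ht => simp [subst, coeff, offset, hs, ht, add_dotProduct]; ring
  | smul α t ht => simp [subst, coeff, offset, ht, mul_add]
  | const β => simp [subst, coeff, offset]

theorem coeff_linComb (c : Fin n → ℝ) : (linComb c).coeff = c := by
  have h : ∀ l : List (Val n), (l.foldr add (const 0)).coeff = (l.map coeff).sum := by
    intro l
    induction l with
    | nil => rfl
    | cons a l ih => simp [coeff, ih]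
  rw [linComb, h, List.map_ofFn, List.sum_ofFn]
  ext i
  simp [coeff, Pi.single_apply]

theorem offset_linComb (c : Fin n → ℝ) : (linComb c).offset = 0 := by
  have h : ∀ l : List (Val n), (l.foldr add (const 0)).offset = (l.map offset).sum := by
    intro l
    induction l with
    | nil => rfl
    | cons a l ih => simp [offset, ih]
  rw [linComb, h, List.map_ofFn, List.sum_ofFn]
  simp [offset]

/-- An equation that is derivable from the hypotheses `H`, each of which is a multiple of `s = t`
as an equation between affine functions, is itself such a multiple. -/
theorem Entails.exists_smul {s t : Val n} {H : Val n → Val n → Prop}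
    (hH : ∀ u v, H u v → ∃ c : ℝ, u.coeff - v.coeff = c • (s.coeff - t.coeff) ∧
      u.offset - v.offset = c * (s.offset - t.offset)) {u v : Val n} (h : Entails H u v) :
    ∃ c : ℝ, u.coeff - v.coeff = c • (s.coeff - t.coeff) ∧
      u.offset - v.offset = c * (s.offset - t.offset) := by
  induction h with
  | hyp h => exact hH _ _ h
  | symm _ ih =>
    obtain ⟨c, h1, h2⟩ := ih
    exact ⟨-c, by rw [neg_smul, ← h1, neg_sub], by rw [neg_mul, ← h2, neg_sub]⟩
  | trans _ _ ih ih' =>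
    obtain ⟨c, h1, h2⟩ := ih
    obtain ⟨c', h1', h2'⟩ := ih'
    exact ⟨c + c', by rw [_root_.add_smul, ← h1, ← h1']; abel, by rw [add_mul, ← h2, ← h2']; ring⟩
  | add_congr _ _ ih ih' =>
    obtain ⟨c, h1, h2⟩ := ih
    obtain ⟨c', h1', h2'⟩ := ih'
    exact ⟨c + c', by rw [_root_.add_smul, ← h1, ← h1']; simp only [coeff]; abel,
      by rw [add_mul, ← h2, ← h2']; simp only [offset]; ring⟩
  | smul_congr α _ ih =>
    obtain ⟨c, h1, h2⟩ := ih
    exact ⟨α * c, by rw [← smul_smul, ← h1]; simp only [coeff, smul_sub],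
      by rw [mul_assoc, ← h2]; simp only [offset]; ring⟩
  -- Reflexivity and the vector space axioms relate expressions with the same affine function, so
  -- the multiple is `0`.
  | _ =>
    refine ⟨0, ?_, ?_⟩
    · ext i
      simp [coeff]
      try ring
    · simp [offset]
      try ring

theorem Eqv.coeff_eq {s t : Val n} (h : Eqv s t) : s.coeff = t.coeff := by
  obtain ⟨c, h1, -⟩ := Entails.exists_smul (s := const 0) (t := const 0) (fun _ _ h => h.elim) h
  simpa [coeff, sub_eq_zero] using h1

theorem Eqv.offset_eq {s t : Val n} (h : Eqv s t) : s.offset = t.offset := by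
  obtain ⟨c, -, h2⟩ := Entails.exists_smul (s := const 0) (t := const 0) (fun _ _ h => h.elim) h
  simpa [offset, sub_eq_zero] using h2

theorem push_denote {k : ℕ} (v : Fin k → Val n) (e : Pot (Fin n)) : (denote v).push e =
    fun w r => e (w ᵥ* Matrix.of fun i => (v i).coeff) (r - w ⬝ᵥ fun i => (v i).offset) := by
  funext w r
  simp only [Hom.push, denote, Hom.cum_affine]
  rfl

end Val

/-! ### The action of programs on potentials. -/

namespace Pot

variable {n : ℕ}

/-- The potential after an independent standard normal variable is adjoined. -/
noncomputable def sample (e : Pot (Fin n)) : Pot (Fin (n + 1)) := fun w r =>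
  e (w ∘ Fin.castSucc) (r - w (Fin.last n) ^ 2 / 2)

/-- The potential after conditioning on `s = t`. -/
def check (s t : Val n) (e : Pot (Fin n)) : Pot (Fin n) := fun w r =>
  ∃ c : ℝ, e (w + c • (s.coeff - t.coeff)) (r - c * (s.offset - t.offset))

end Pot

namespace Prog

variable {n m k : ℕ}

/-- The transformation of potentials denoted by a program. -/
def sem (t : Prog n k) : Pot (Fin n) → Pot (Fin k) := (interp t).push

theorem push_sample (e : Pot (Fin n)) : (sample n).push e = e.sample := by
  funext w r
  have h : w ∘ finSumFinEquiv = Sum.elim (w ∘ Fin.castSucc) fun _ : Fin 1 => w (Fin.last n) := by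
    ext (i | i)
    · rfl
    · fin_cases i
      rfl
  have hc : Hom.stdNormal.cum (fun _ : Fin 1 => w (Fin.last n)) = w (Fin.last n) ^ 2 / 2 := by
    simp [Hom.cum, Hom.stdNormal, dotProduct, sq]
  rw [sample, Hom.push_comp, Hom.push_wire, Hom.vecMul_wire_equiv, Equiv.symm_symm, h,
    Hom.push_comp, Hom.push_tensor, Hom.push_wire, Hom.vecMul_wire_elim_id, Hom.vecMul_id_lin,
    Hom.cum_id, hc, zero_add]
  rfl

theorem push_check (s t : Val n) (e : Pot (Fin n)) : (check s t).push e = e.check s t := by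
  change Hom.observe (Hom.pair (Hom.id (Fin n)) (Val.denote fun _ : Fin 1 => s.sub t)) 0 e = _
  funext w r
  have h : ∀ u : Fin 1 → ℝ, (Hom.pair (Hom.id (Fin n)) (Val.denote fun _ : Fin 1 =>
      s.sub t)).push e (Sum.elim w u) (r + u ⬝ᵥ 0) ↔
      e (w + u 0 • (s.coeff - t.coeff)) (r - u 0 * (s.offset - t.offset)) := by
    intro u
    rw [Hom.push_pair, Hom.vecMul_id_lin, Hom.cum_id, Val.denote, Hom.cum_affine]
    have h1 : u ᵥ* (Matrix.of fun _ : Fin 1 => (s.sub t).coeff) =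
        u 0 • (s.coeff - t.coeff) := by
      ext i
      simp [Matrix.vecMul, dotProduct, Val.sub, Val.coeff, sub_eq_add_neg]
    have h2 : (u ⬝ᵥ fun _ : Fin 1 => (s.sub t).offset) = u 0 * (s.offset - t.offset) := by
      simp [dotProduct, Val.sub, Val.offset, sub_eq_add_neg]
    rw [h2]
    simp only [Hom.affine]
    rw [h1]
    simp
  apply propext
  exact ⟨fun ⟨u, hu⟩ => ⟨u 0, (h u).1 hu⟩, fun ⟨c, hc⟩ => ⟨fun _ => c, (h _).2 hc⟩⟩

theorem sem_nu (t : Prog (n + 1) k) (e : Pot (Fin n)) : (nu t).sem e = t.sem e.sample := by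
  rw [sem, interp, ObsHom.push_comp, ObsHom.push_J, push_sample]
  rfl

theorem sem_cond (s t : Val n) (u : Prog n k) (e : Pot (Fin n)) :
    (cond s t u).sem e = u.sem (e.check s t) := by
  rw [sem, interp, ObsHom.push_comp, push_check]
  rfl

theorem sem_ret (v : Fin k → Val n) (e : Pot (Fin n)) : (ret v).sem e =
    fun w r => e (w ᵥ* Matrix.of fun i => (v i).coeff) (r - w ⬝ᵥ fun i => (v i).offset) := by
  rw [sem, interp, ObsHom.push_J, Val.push_denote]

/-- The functional on the extra output contributes nothing to the constant `0` but is paired with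
the observed `1`, so it moves the bound freely. -/
theorem sem_bot (e : Pot (Fin n)) : (bot : Prog n k).sem e = fun _ r => ∃ c : ℝ, e 0 (r + c) := by
  change Hom.observe (Z := Fin 1) (Hom.affine 0 0) (fun _ => 1) e = _
  funext w r
  apply propext
  simp only [Hom.observe, Hom.push, Hom.cum_affine]
  simp only [Hom.affine]
  constructor
  · rintro ⟨u, hu⟩
    exact ⟨u 0, by simpa [dotProduct] using hu⟩
  · rintro ⟨c, hc⟩
    exact ⟨fun _ => c, by simpa [dotProduct] using hc⟩

theorem sem_unit (e : Pot (Fin n)) : (unit : Prog n 0).sem e = fun _ r => e 0 r := by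
  funext w r
  rw [unit, sem_ret, Subsingleton.elim w 0]
  simp

theorem sem_nus (t : Prog n k) (e : Pot (Fin 0)) :
    (nus n t).sem e = t.sem fun w r => e 0 (r - (w ⬝ᵥ w) / 2) := by
  induction n with
  | zero =>
    rw [nus]
    congr 1
    funext w r
    rw [Subsingleton.elim w 0]
    simp
  | succ n ih =>
    rw [nus, ih, sem_nu]
    congr 1
    funext w r
    simp only [Pot.sample, dotProduct, Fin.sum_univ_castSucc, Function.comp]
    ring_nf

/-! ### Substitution -/

theorem coeff_lift_castSucc (σ : Fin n → Val m) (i : Fin n) :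
    (lift σ i.castSucc).coeff = Fin.snoc (α := fun _ => ℝ) (σ i).coeff 0 := by
  rw [lift, Fin.snoc_castSucc, Val.coeff_subst]
  ext j
  refine Fin.lastCases ?_ (fun j => ?_) j <;>
    simp [Matrix.vecMul, dotProduct, Val.coeff, Pi.single_apply]

theorem offset_lift_castSucc (σ : Fin n → Val m) (i : Fin n) :
    (lift σ i.castSucc).offset = (σ i).offset := by
  rw [lift, Fin.snoc_castSucc, Val.offset_subst]
  simp [Val.offset, dotProduct]

theorem lift_last (σ : Fin n → Val m) : lift σ (Fin.last n) = Val.var (Fin.last m) := by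
  simp [lift]

theorem sem_subst (σ : Fin n → Val m) (t : Prog n k) (e : Pot (Fin m)) :
    (subst σ t).sem e = t.sem ((Val.denote σ).push e) := by
  induction t generalizing m with
  | nu t ih =>
    rw [subst, sem_nu, ih, sem_nu]
    congr 1
    funext w r
    simp only [Val.push_denote, Pot.sample]
    -- The lifted substitution is block diagonal: `σ` on the context and the identity on the bound
    -- variable.
    have h1 : (w ᵥ* Matrix.of fun i => (lift σ i).coeff) ∘ Fin.castSucc =
        (w ∘ Fin.castSucc) ᵥ* Matrix.of fun i => (σ i).coeff := by
      ext j
      simp [Matrix.vecMul, dotProduct, Fin.sum_univ_castSucc, coeff_lift_castSucc, lift_last,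
        Val.coeff]
    have h2 : (w ᵥ* Matrix.of fun i => (lift σ i).coeff) (Fin.last _) = w (Fin.last _) := by
      simp [Matrix.vecMul, dotProduct, Fin.sum_univ_castSucc, coeff_lift_castSucc, lift_last,
        Val.coeff]
    have h3 : (w ⬝ᵥ fun i => (lift σ i).offset) =
        (w ∘ Fin.castSucc) ⬝ᵥ fun i => (σ i).offset := by
      simp [dotProduct, Fin.sum_univ_castSucc, offset_lift_castSucc, lift_last, Val.offset]
    rw [h1, h2, h3, sub_right_comm]
  | cond a b u ih =>
    rw [subst, sem_cond, ih, sem_cond]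
    congr 1
    funext w r
    simp only [Val.push_denote, Pot.check, Val.coeff_subst, Val.offset_subst]
    refine propext (exists_congr fun c => iff_of_eq ?_)
    congr 1
    · simp [Matrix.add_vecMul, Matrix.smul_vecMul, Matrix.sub_vecMul]
    · simp only [add_dotProduct, smul_dotProduct, sub_dotProduct, smul_eq_mul]
      ring
  | ret v =>
    rw [subst, sem_ret, sem_ret]
    funext w r
    simp only [Val.push_denote, Val.coeff_subst, Val.offset_subst]
    congr 1
    · rw [Matrix.vecMul_vecMul]
      rfl
    · rw [← Matrix.dotProduct_mulVec, sub_sub, ← dotProduct_add]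
      congr 2
      ext i
      simp [Matrix.mulVec, add_comm]
  | bot =>
    rw [subst, sem_bot, sem_bot]
    simp only [Val.push_denote]
    simp

theorem sem_apply_of_forall (t : Prog n k) {e : Pot (Fin n)} (h : ∀ w r, e w r)
    (w : Fin k → ℝ) (r : ℝ) : t.sem e w r := ⟨0, h _ _⟩

/-- The substitution that inserts an unused variable before the last `m` variables. -/
def weaken (n m : ℕ) : Fin (n + m) → Val (n + 1 + m) :=
  Fin.addCases (fun i : Fin n => Val.var (Fin.castAdd m i.castSucc))
    fun j : Fin m => Val.var (Fin.natAdd (n + 1) j)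

/-- Both `t` and `u` read the context, so it is copied. Dually, the functional `y` arising from `t`
is added to the context part of `z`. Non-emptiness serves the case of `⊥`, where both sides hold
everywhere. -/
theorem sem_bind (t : Prog n m) (u : Prog (n + m) k) (e : Pot (Fin n)) (he : ∀ w, ∃ r, e w r) :
    (bind t u).sem e = u.sem fun z => t.sem (fun y => e (y + z ∘ Fin.castAdd m))
      (z ∘ Fin.natAdd n) := by
  induction t generalizing k with
  | @nu n m t ih =>
    rw [bind]
    change (nu (bind t (subst (weaken n m) u))).sem e = _
    rw [sem_nu, ih _ _ fun w => ?_, sem_subst]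
    · congr 1
      funext z r
      rw [sem_nu, Val.push_denote]
      have hne : ∀ (i : Fin m) (j : Fin (n + 1)), Fin.natAdd (n + 1) i ≠ Fin.castAdd m j := by
        intro i j h
        have := Fin.ext_iff.1 h
        simp only [Fin.val_natAdd, Fin.val_castAdd] at this
        omega
      have h1 : (z ᵥ* Matrix.of fun i => (weaken n m i).coeff) ∘ Fin.natAdd (n + 1) =
          z ∘ Fin.natAdd n := by
        ext j
        simp [weaken, Matrix.vecMul, dotProduct, Fin.sum_univ_add, Val.coeff, Pi.single_apply, hne]
      have h2 : (z ᵥ* Matrix.of fun i => (weaken n m i).coeff) ∘ Fin.castAdd m =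
          Fin.snoc (α := fun _ => ℝ) (z ∘ Fin.castAdd m) 0 := by
        ext j
        refine Fin.lastCases ?_ (fun j => ?_) j <;>
          simp [weaken, Matrix.vecMul, dotProduct, Fin.sum_univ_add, Val.coeff, Pi.single_apply,
            (hne _ _).symm]
      have h3 : (z ⬝ᵥ fun i => (weaken n m i).offset) = 0 := by
        simp [weaken, dotProduct, Fin.sum_univ_add, Val.offset]
      beta_reduce
      rw [h1, h2, h3, sub_zero]
      congr 1
      funext y r
      -- The continuation does not mention the bound variable, so its functional has last coordinate
      -- `0` and leaves the square in `Pot.sample` unchanged.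
      have h4 : (y + Fin.snoc (α := fun _ => ℝ) (z ∘ Fin.castAdd m) 0) ∘ Fin.castSucc =
          y ∘ Fin.castSucc + z ∘ Fin.castAdd m := by
        ext j
        simp
      simp only [Pot.sample, h4]
      simp
    · obtain ⟨r, hr⟩ := he (w ∘ Fin.castSucc)
      exact ⟨r + w (Fin.last _) ^ 2 / 2, by simpa [Pot.sample] using hr⟩
  | cond a b t ih =>
    rw [bind, sem_cond, ih _ _ fun w => ?_]
    · congr 1
      funext z
      rw [sem_cond]
      congr 1
      funext y r
      simp only [Pot.check]
      simp only [add_right_comm]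
    · obtain ⟨r, hr⟩ := he w
      exact ⟨r, 0, by simpa using hr⟩
  | ret v =>
    rw [bind, sem_subst]
    congr 1
    funext z r
    rw [sem_ret, Val.push_denote]
    have h1 : (z ᵥ* Matrix.of fun i => (Fin.addCases Val.var v i : Val _).coeff) =
        (z ∘ Fin.natAdd _) ᵥ* (Matrix.of fun i => (v i).coeff) + z ∘ Fin.castAdd _ := by
      ext j
      simp [Matrix.vecMul, dotProduct, Fin.sum_univ_add, Val.coeff, Pi.single_apply, add_comm]
    have h2 : (z ⬝ᵥ fun i => (Fin.addCases Val.var v i : Val _).offset) =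
        (z ∘ Fin.natAdd _) ⬝ᵥ fun i => (v i).offset := by
      simp [dotProduct, Fin.sum_univ_add, Val.offset]
    simp only [h1, h2]
  | bot =>
    rw [bind, sem_bot]
    funext w r
    obtain ⟨s, hs⟩ := he 0
    refine propext (iff_of_true ⟨s - r, by simpa using hs⟩ (sem_apply_of_forall _ ?_ _ _))
    intro z r
    obtain ⟨s, hs⟩ := he (0 + z ∘ Fin.castAdd _)
    rw [sem_bot]
    exact ⟨s - r, by simpa using hs⟩

end Prog
-- Equality of denotations in terms of potentials.
theorem ObsHom.curry_pot_whisker_comp {A X Y : Type} [Fintype A] [Fintype X] [Fintype Y]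
    (f : ObsHom X Y) (ψ : ObsHom (Fin 0) (A ⊕ X)) (a : A → ℝ) :
    (fun y => ((f.whisker A).comp ψ).pot (Sum.elim a y)) =
      f.push fun x => ψ.pot (Sum.elim a x) :=
  funext fun w => funext fun r => propext (pot_whisker_comp f ψ a w r)

namespace Prog

variable {n m k : ℕ}

theorem denote_eq_iff {t u : Prog n k} : t.denote = u.denote ↔
    ∀ (A : Type) [Fintype A] (ψ : ObsHom (Fin 0) (A ⊕ Fin n)), ∃ c : ℝ, ∀ (a : A → ℝ) w r,
      t.sem (fun x => ψ.pot (Sum.elim a x)) w r ↔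
        u.sem (fun x => ψ.pot (Sum.elim a x)) w (r + c) :=
  Quotient.eq.trans ObsHom.equivalent_iff

/-- Programs with the same action on potentials up to a constant denote the same morphism. -/
theorem denote_eq_of_sem {t u : Prog n k} (c : ℝ)
    (h : ∀ e : Pot (Fin n), (∀ w, ∃ r, e w r) → (∀ w r r', r ≤ r' → e w r → e w r') →
      ∀ w r, t.sem e w r ↔ u.sem e w (r + c)) : t.denote = u.denote :=
  denote_eq_iff.2 fun _ _ ψ => ⟨c, fun _ => h _ (fun _ => ψ.pot_nonempty _)
    fun _ _ _ hr => ψ.pot_mono hr⟩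

theorem denote_eq_of_sem_eq {t u : Prog n k}
    (h : ∀ e : Pot (Fin n), t.sem e = u.sem e) : t.denote = u.denote :=
  denote_eq_of_sem 0 fun e _ _ w r => by rw [h, add_zero]

/-! ### Validity of the axioms -/

theorem dotProduct_vecMul_self {U : Matrix (Fin n) (Fin n) ℝ}
    (hU : U ∈ Matrix.orthogonalGroup (Fin n) ℝ) (w : Fin n → ℝ) :
    (w ᵥ* U) ⬝ᵥ (w ᵥ* U) = w ⬝ᵥ w := by
  rw [← Matrix.dotProduct_mulVec, ← Matrix.mulVec_transpose, Matrix.mulVec_mulVec,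
    (Matrix.mem_orthogonalGroup_iff _ _).1 hU, Matrix.one_mulVec]

theorem IsAxiom.denote_eq {t u : Prog n k} (h : IsAxiom t u) : t.denote = u.denote := by
  cases h with
  | DISC =>
    refine denote_eq_of_sem_eq fun e => ?_
    funext w r
    rw [sem_nu, sem_unit, sem_unit]
    simp only [Pot.sample]
    simp
  | ORTH n U hU =>
    refine denote_eq_of_sem_eq fun e => ?_
    funext w r
    have h1 : (Matrix.of fun i => (Val.linComb (U i)).coeff) = U := by
      simp only [Val.coeff_linComb]
      rfl
    have h2 : (Matrix.of fun i => (Val.var i : Val k).coeff) = 1 := by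
      ext i j
      simp [Val.coeff, Matrix.one_apply, Pi.single_apply, eq_comm]
    simp only [sem_nus, sem_ret, h1, h2, dotProduct_vecMul_self hU, Val.offset_linComb,
      Val.offset, Matrix.vecMul_one]
  | C1 =>
    refine denote_eq_of_sem_eq fun e => ?_
    funext w r
    simp only [sem_cond, sem_unit, Pot.check, add_right_comm, sub_right_comm]
    exact propext exists_comm
  | C2 =>
    refine denote_eq_of_sem_eq fun e => ?_
    funext w r
    simp only [sem_cond, sem_nu, sem_ret, Pot.check, Pot.sample]
    refine propext (exists_congr fun c => iff_of_eq ?_)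
    congr 1
    · ext j
      fin_cases j <;> simp [Matrix.vecMul, dotProduct, Val.coeff]
    · simp [Val.coeff, Val.offset]
  | C3 =>
    refine denote_eq_of_sem 0 fun e he _ w r => ?_
    simp only [sem_cond, sem_bot, Pot.check]
    obtain ⟨s, hs⟩ := he 0
    -- Both sides are always true because the potential is non-empty at `0`.
    exact iff_of_true ⟨s - r, 0, by simpa using hs⟩ ⟨s - (r + 0), by simpa using hs⟩
  | TAUT =>
    refine denote_eq_of_sem_eq fun e => ?_
    funext w r
    simp only [sem_cond, sem_unit, Pot.check]
    simp
  | FAIL =>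
    refine denote_eq_of_sem_eq fun e => ?_
    funext w r
    simp only [sem_cond, sem_unit, sem_bot, Pot.check]
    simp [Val.coeff, Val.offset]
  | SUBS =>
    refine denote_eq_of_sem_eq fun e => ?_
    funext w r
    simp only [sem_cond, sem_ret, Pot.check]
    have h : ∀ i : Fin 2, (w ᵥ* Matrix.of fun _ : Fin 1 => (Val.var i).coeff) = Pi.single i (w 0) := by
      intro i
      ext j
      simp [Matrix.vecMul, dotProduct, Val.coeff, Pi.single_apply]
    rw [h, h]
    -- The functionals `w 0 • a` and `w 0 • b` differ by a multiple of `a - b`, which a shift of the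
    -- multiplier absorbs.
    refine propext ⟨fun ⟨c, hc⟩ => ⟨c + w 0, ?_⟩, fun ⟨c, hc⟩ => ⟨c - w 0, ?_⟩⟩
    · convert hc using 1
      · ext j
        fin_cases j <;> simp [Val.coeff] <;> ring
      · simp [Val.offset]
    · convert hc using 1
      · ext j
        fin_cases j <;> simp [Val.coeff] <;> ring
      · simp [Val.offset]
  | INIT c =>
    -- The constant is the unnormalized negative log-density of the standard normal at `c`. The
    -- multiplier `b = c - w 0` is the optimal one, and any other loses `(w 0 + b - c) ^ 2 / 2`.
    refine denote_eq_of_sem (c ^ 2 / 2) fun e _ hm w r => ?_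
    simp only [sem_cond, sem_nu, sem_ret, Pot.check, Pot.sample]
    have h : ∀ b : ℝ, ((w ᵥ* Matrix.of fun _ : Fin 1 => (Val.var 0 : Val 1).coeff) +
        b • ((Val.var 0 : Val 1).coeff - (Val.const c).coeff) : Fin 1 → ℝ) (Fin.last 0) =
          w 0 + b := by
      intro b
      simp [Matrix.vecMul, dotProduct, Val.coeff]
    have h1 : (w ⬝ᵥ fun _ => (Val.const c : Val 0).offset) = w 0 * c := by
      simp [dotProduct, Val.offset]
    have h2 : (w ⬝ᵥ fun _ => (Val.var 0 : Val 1).offset) = 0 := by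
      simp [dotProduct, Val.offset]
    simp only [h, h1, h2]
    simp only [Val.offset]
    constructor
    · rintro ⟨b, hb⟩
      rw [Subsingleton.elim (_ ∘ _) (w ᵥ* Matrix.of fun _ => (Val.const c : Val 0).coeff)] at hb
      refine hm _ _ _ ?_ hb
      nlinarith [sq_nonneg (w 0 + b - c)]
    · intro hr
      refine ⟨c - w 0, ?_⟩
      rw [Subsingleton.elim (_ ∘ _) (w ᵥ* Matrix.of fun _ => (Val.const c : Val 0).coeff)]
      convert hr using 1
      ring
  | CONG s t s' t' h =>
    refine denote_eq_of_sem_eq fun e => ?_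
    funext w r
    -- A derivable equation is a multiple of the given one, so shifts along it are shifts along the
    -- other. The two derivations give the two inclusions, and the multiple may be zero.
    have key : ∀ {s t s' t' : Val n}, Val.Entails (fun u v => u = s ∧ v = t) s' t' →
        e.check s' t' 0 r → e.check s t 0 r := by
      rintro s t s' t' h ⟨b, hb⟩
      obtain ⟨c, h1, h2⟩ := h.exists_smul (s := s) (t := t) (by
        rintro u v ⟨rfl, rfl⟩
        exact ⟨1, by simp, by simp⟩)
      refine ⟨b * c, ?_⟩
      rwa [mul_smul, mul_assoc, ← h1, ← h2]
    rw [sem_cond, sem_cond, sem_unit, sem_unit]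
    exact propext ⟨key h.2, key h.1⟩

/-! ### Soundness -/

theorem Derivable.denote_eq {t u : Prog n k} (h : Derivable t u) : t.denote = u.denote := by
  induction h with
  | ax h => exact h.denote_eq
  | refl => rfl
  | symm _ ih => exact ih.symm
  | trans _ _ ih ih' => exact ih.trans ih'
  | nu_congr _ ih =>
    rw [denote_eq_iff] at ih ⊢
    intro A _ ψ
    -- Test the hypothesis on the state extended by the sampled variable.
    obtain ⟨c, hc⟩ := ih A (((ObsHom.J (sample _)).whisker A).comp ψ)
    refine ⟨c, fun a w r => ?_⟩
    have := hc a w r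
    simp only [ObsHom.curry_pot_whisker_comp, ObsHom.push_J, push_sample, sem_nu] at this ⊢
    exact this
  | @cond_congr n k s s' t t' _ _ hs ht _ ih =>
    rw [denote_eq_iff] at ih ⊢
    intro A _ ψ
    obtain ⟨c, hc⟩ := ih A (((check s t).whisker A).comp ψ)
    refine ⟨c, fun a w r => ?_⟩
    have := hc a w r
    rw [ObsHom.curry_pot_whisker_comp, push_check] at this
    have h : ∀ e : Pot (Fin n), e.check s' t' = e.check s t := by
      intro e
      unfold Pot.check
      rw [hs.coeff_eq, hs.offset_eq, ht.coeff_eq, ht.offset_eq]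
    rwa [sem_cond, sem_cond, h]
  | ret_congr h =>
    refine denote_eq_of_sem_eq fun e => ?_
    simp only [sem_ret, (h _).coeff_eq, (h _).offset_eq]
  | subst σ _ ih =>
    rw [denote_eq_iff] at ih ⊢
    intro A _ ψ
    obtain ⟨c, hc⟩ := ih A (((ObsHom.J (Val.denote σ)).whisker A).comp ψ)
    refine ⟨c, fun a w r => ?_⟩
    have := hc a w r
    simp only [ObsHom.curry_pot_whisker_comp, ObsHom.push_J] at this
    rw [sem_subst, sem_subst]
    exact this
  | @bind n m k t t' u u' _ _ ih ih' =>
    rw [denote_eq_iff] at ih ih' ⊢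
    intro A _ ψ
    let dup : Hom (A ⊕ Fin n) ((A ⊕ Fin n) ⊕ Fin n) := Hom.wire (Sum.elim _root_.id Sum.inr)
    let reassoc : (A ⊕ Fin (n + m)) ≃ (A ⊕ Fin n) ⊕ Fin m :=
      ((Equiv.refl A).sumCongr finSumFinEquiv.symm).trans (Equiv.sumAssoc A (Fin n) (Fin m)).symm
    have hdup : ∀ a x, (fun y => ((ObsHom.J dup).comp ψ).pot (Sum.elim (Sum.elim a x) y)) =
        fun y => ψ.pot (Sum.elim a (y + x)) := by
      intro a x
      funext y r
      rw [ObsHom.pot_comp, ObsHom.push_J, Hom.push_wire, Hom.vecMul_wire_elim_inr]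
    have hreassoc : ∀ (φ : ObsHom (Fin 0) ((A ⊕ Fin n) ⊕ Fin m)) a z r,
        ((ObsHom.J (Hom.wire reassoc)).comp φ).pot (Sum.elim a z) r ↔
        φ.pot (Sum.elim (Sum.elim a (z ∘ Fin.castAdd m)) (z ∘ Fin.natAdd n)) r := by
      intro φ a z r
      rw [ObsHom.pot_comp, ObsHom.push_J, Hom.push_wire, Hom.vecMul_wire_equiv]
      have h : Sum.elim a z ∘ reassoc.symm =
          Sum.elim (Sum.elim a (z ∘ Fin.castAdd m)) (z ∘ Fin.natAdd n) := by
        ext ((i | i) | i) <;> rfl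
      rw [h]
    -- One copy of the context is kept as a parameter, so `c` does not depend on the functional on
    -- it and passes through the continuation by `push_shift`. The constant `c'` then comes from
    -- running `u` and `u'` after `t'`.
    obtain ⟨c, hc⟩ := ih (A ⊕ Fin n) ((ObsHom.J dup).comp ψ)
    obtain ⟨c', hc'⟩ := ih' A ((ObsHom.J (Hom.wire reassoc)).comp
      (((interp t').whisker (A ⊕ Fin n)).comp ((ObsHom.J dup).comp ψ)))
    have hpot : ∀ a, (fun z => ((ObsHom.J (Hom.wire reassoc)).comp
        (((interp t').whisker (A ⊕ Fin n)).comp ((ObsHom.J dup).comp ψ))).pot (Sum.elim a z)) =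
        fun z => t'.sem (fun y => ψ.pot (Sum.elim a (y + z ∘ Fin.castAdd m)))
          (z ∘ Fin.natAdd n) := by
      intro a
      funext z r
      rw [hreassoc, ObsHom.pot_whisker_comp, hdup]
      rfl
    refine ⟨c + c', fun a w r => ?_⟩
    rw [sem_bind _ _ _ fun _ => ψ.pot_nonempty _, sem_bind _ _ _ fun _ => ψ.pot_nonempty _,
      ← add_assoc]
    have h1 := hc' a w (r + c)
    rw [hpot] at h1
    rw [← h1]
    refine ObsHom.push_shift _ (fun z s => ?_) w r
    have h2 := hc (Sum.elim a (z ∘ Fin.castAdd m)) (z ∘ Fin.natAdd n) s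
    rwa [hdup] at h2

theorem not_derivable_unit_bot : ¬ Derivable (unit : Prog 0 0) (bot : Prog 0 0) := by
  intro h
  have := denote_eq_iff.1 h.denote_eq (Fin 0) (ObsHom.J (Hom.affine 0 0))
  obtain ⟨c, hc⟩ := this
  -- The test state has potential `0 ≤ r`: failure accepts every bound, whereas `r[]` rejects `-1`.
  have h1 := (hc 0 0 (-1)).2 (by
    rw [sem_bot]
    exact ⟨1 - c, by simp [ObsHom.pot, ObsHom.push_J, Hom.push, Hom.cum_affine]⟩)
  rw [sem_unit] at h1
  simp [ObsHom.pot, ObsHom.push_J, Hom.push, Hom.cum_affine] at h1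
  linarith

end Prog
end CondGauss

theorem mainTheorem8 :
    (∀ (n k : ℕ) (t u : CondGauss.Prog n k), CondGauss.Prog.IsAxiom t u → t.denote = u.denote) ∧
    (∀ (n k : ℕ) (t u : CondGauss.Prog n k), CondGauss.Prog.Derivable t u → t.denote = u.denote) ∧
    ¬ CondGauss.Prog.Derivable
      (CondGauss.Prog.unit : CondGauss.Prog 0 0) (CondGauss.Prog.bot : CondGauss.Prog 0 0) :=
  ⟨fun _ _ _ _ h => h.denote_eq, fun _ _ _ _ h => h.denote_eq,
    CondGauss.Prog.not_derivable_unit_bot⟩
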